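/- **Setting.** Let $E$ be a finite-dimensional real normed space with norm $\|\cdot\|$ and dual norm $\|\cdot\|_*$. A *group DRO problem* with $n$ groups consists of a nonempty compact convex parameter set $\Theta\subseteq E$, a loss $\ell:\Theta\times\mathcal Z\to[0,1]$ that is measurable in the datapoint $z\in\mathcal Z$ and convex in the parameter $\theta$, and probability distributions $D_1,\dots,D_n$ on $\mathcal Z$ (not necessarily distinct). A parameter $\theta\in\Theta$ is *$\epsilon$-optimal* if $$\max_{i}\mathbb E_{z\sim D_i}\ell(\theta,z)\le \mathrm{OPT}+\epsilon,\qquad \mathrm{OPT}=\min_{\theta^*\in\Theta}\max_{i}\mathbb E_{z\sim D_i}\ell(\theta^*,z).$$ The loss is *$1$-smooth* if $\|\nabla_\theta\ell(\theta,z)\|_*\le 1$ for all $\theta\in\Theta$, $z\in\mathcal Z$. A *distance-generating function* on $\Theta$ is a continuous function $\omega:\Theta\to\mathbb R$ that is strongly convex with modulus $1$ with respect to $\|\cdot\|$, such that the set $\Theta^o$ of points of $\Theta$ with $\partial\omega\neq\emptyset$ is nonempty, together with a continuous selection $\omega'$ of $\partial\omega$ on $\Theta^o$. Its *Bregman radius*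 is $D_\Theta=\max_{u\in\Theta}\big(\omega(u)-\omega(\theta^c)-\langle\omega'(\theta^c),u-\theta^c\rangle\big)$, where $\theta^c=\operatorname{argmin}_{\Theta^o}\omega$. An *algorithm* may be randomized. It repeatedly and adaptively chooses an index $i\in\{1,\dots,n\}$ and receives a fresh independent sample from $D_i$, until it decides to stop and outputs a parameter. On a given set of problems it is an *$(\epsilon,\delta)$-algorithm* if on each problem of the set it stops and outputs an $\epsilon$-optimal $\theta\in\Theta$ with probability at least $1-\delta$. Its *sample complexity* on a problem is the expected number of samples it draws, and its sample complexity on a set of problems is the worst case over the set. **Statement.** There is a universal constant $c>0$ such that the following holds for all integers $n\ge 1$, all $\epsilon,\delta\in(0,1/8)$ and all real $D_\Theta\ge 1/8$. (A parameter set of unit diameter always has Bregman radius at least $1/8$.) There exist $E$, $\mathcal Z$, a parameter set $\Theta$ of diameter $1$ with a distance-generating function of Bregman radius exactly $D_\Theta$, a convex $1$-smooth loss $\ell$, and a finite set $\mathbb V$ of group DRO problems with $n$ groups, all with this $\Theta$ and $\ell$ and differing only in the data distributions, such that every $(\epsilon,\delta)$-algorithm on $\mathbb V$ has, on at least one problem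 of $\mathbb V$, sample complexity at least $$c\cdot\frac{D_\Theta+n\log(\min\{n,D_\Theta\}/\delta)}{\epsilon^2}.$$ -/

import Mathlib

open MeasureTheory

noncomputable section

namespace GroupDRO

/-- The known part of a group DRO problem: a nonempty compact convex parameter set `Θ` of a normed
space `E`, and a loss `loss θ z ∈ [0, 1]` (the loss of the hypothesis with parameter `θ` on the
datapoint `z`) which is convex in the parameter. -/
structure Model (E Z : Type) [NormedAddCommGroup E] [NormedSpace ℝ E] [MeasurableSpace Z] where
  Θ : Set E
  loss : E → Z → ℝ
  nonempty_params : Θ.Nonempty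
  convex_params : Convex ℝ Θ
  compact_params : IsCompact Θ
  measurable_loss : ∀ θ ∈ Θ, Measurable (loss θ)
  loss_mem : ∀ θ ∈ Θ, ∀ z, loss θ z ∈ Set.Icc (0 : ℝ) 1
  convex_loss : ∀ z, ConvexOn ℝ Θ (fun θ => loss θ z)

section Model

variable {E Z : Type} [NormedAddCommGroup E] [NormedSpace ℝ E] [MeasurableSpace Z]

/-- `1`-smoothness: for every datapoint the loss is differentiable in the parameter, with a
gradient of (dual) norm at most `1` at every parameter in `Θ`. -/
def Model.IsOneSmooth (M : Model E Z) : Prop :=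
  ∀ z, ∀ θ ∈ M.Θ, ∃ g : StrongDual ℝ E,
    HasFDerivWithinAt (fun θ' => M.loss θ' z) g M.Θ θ ∧ ‖g‖ ≤ 1

/-- Expected loss of the parameter `θ` under the data distribution `P`. -/
def Model.risk (M : Model E Z) (P : ProbabilityMeasure Z) (θ : E) : ℝ :=
  ∫ z, M.loss θ z ∂(P : Measure Z)

/-- Worst expected loss over the data distributions `P 0, …, P (n - 1)`. -/
def Model.worstRisk (M : Model E Z) {n : ℕ} (P : Fin n → ProbabilityMeasure Z) (θ : E) : ℝ :=
  ⨆ i, M.risk (P i) θ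

/-- The best worst-case risk attainable in `Θ`. -/
def Model.opt (M : Model E Z) {n : ℕ} (P : Fin n → ProbabilityMeasure Z) : ℝ :=
  sInf (M.worstRisk P '' M.Θ)

/-- `θ` is a (proper) `ε`-optimal solution of the group DRO problem `(M, P)`. -/
def Model.IsEpsOptimal (M : Model E Z) {n : ℕ} (P : Fin n → ProbabilityMeasure Z) (ε : ℝ)
    (θ : E) : Prop :=
  θ ∈ M.Θ ∧ M.worstRisk P θ ≤ M.opt P + ε

end Model

section Bregman

variable {E : Type} [NormedAddCommGroup E] [NormedSpace ℝ E]

/-- Subdifferential at `θ` of a function `ω` on the set `Θ`. -/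
def subdifferential (Θ : Set E) (ω : E → ℝ) (θ : E) : Set (StrongDual ℝ E) :=
  {g | ∀ u ∈ Θ, ω θ + g (u - θ) ≤ ω u}

/-- The set `Θᵒ` of the points of `Θ` at which `ω` has a subgradient. -/
def proxDomain (Θ : Set E) (ω : E → ℝ) : Set E :=
  {θ | θ ∈ Θ ∧ (subdifferential Θ ω θ).Nonempty}

/-- `ω` is a distance-generating function on `Θ` (continuous, strongly convex of modulus `1` with
respect to the norm of `E`), and `ω'` is a continuous selection of its subdifferential on the
nonempty set `Θᵒ`. -/
structure IsDistanceGenerating (Θ : Set E) (ω : E → ℝ) (ω' : E → StrongDual ℝ E) : Prop where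
  continuousOn : ContinuousOn ω Θ
  strongConvexOn : StrongConvexOn Θ 1 ω
  nonempty_proxDomain : (proxDomain Θ ω).Nonempty
  selection : ∀ θ ∈ proxDomain Θ ω, ω' θ ∈ subdifferential Θ ω θ
  continuousOn_selection : ContinuousOn ω' (proxDomain Θ ω)

/-- The Bregman divergence (prox function) `V(w, u) = ω(u) - ω(w) - ⟨ω'(w), u - w⟩`. -/
def bregman (ω : E → ℝ) (ω' : E → StrongDual ℝ E) (w u : E) : ℝ :=
  ω u - ω w - ω' w (u - w)

/-- `θc` is the center of `Θ`: the minimizer of `ω` over `Θᵒ`. -/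
def IsCenter (Θ : Set E) (ω : E → ℝ) (θc : E) : Prop :=
  θc ∈ proxDomain Θ ω ∧ IsMinOn ω (proxDomain Θ ω) θc

/-- `D` is the Bregman radius of `Θ` with respect to `ω`: the maximum over `u ∈ Θ` of `V(θc, u)`,
where `θc` is the center of `Θ`. -/
def IsBregmanRadius (Θ : Set E) (ω : E → ℝ) (ω' : E → StrongDual ℝ E) (D : ℝ) : Prop :=
  ∃ θc, IsCenter Θ ω θc ∧ IsGreatest (bregman ω ω' θc '' Θ) D

end Bregman

section Algorithm

variable {E Z : Type} [MeasurableSpace E] [MeasurableSpace Z]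

/-- A randomized adaptive algorithm with access to `n` example oracles. After `t` oracle calls it
knows its internal randomness and the `t` datapoints it received (the earlier choices of oracles are
functions of these). Based on this it either stops (`halt t`) and returns `output t`, or it calls
the oracle with index `query t`. -/
structure Algorithm (n : ℕ) (E Z : Type) [MeasurableSpace E] [MeasurableSpace Z] where
  Seed : Type
  [measurableSpaceSeed : MeasurableSpace Seed]
  seedLaw : ProbabilityMeasure Seed
  halt : (t : ℕ) → Set (Seed × (Fin t → Z))
  query : (t : ℕ) → Seed × (Fin t → Z) → Fin n
  output : (t : ℕ) → Seed × (Fin t → Z) → E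
  measurableSet_halt : ∀ t, MeasurableSet (halt t)
  measurable_query : ∀ t, Measurable (query t)
  measurable_output : ∀ t, Measurable (output t)

attribute [instance] Algorithm.measurableSpaceSeed

variable {n : ℕ}

/-- The datapoints received in the first `t` calls when the internal randomness is `s` and when
the call number `t` (from `0`), if made to oracle `i`, is answered by `x t i`. (The decision to halt
is ignored here: the values beyond the stopping time are never used.) -/
def Algorithm.transcript (A : Algorithm n E Z) (s : A.Seed) (x : ℕ → Fin n → Z) :
    (t : ℕ) → (Fin t → Z)
  | 0 => Fin.elim0
  | t + 1 => Fin.snoc (α := fun _ => Z) (A.transcript s x t)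
      (x t (A.query t (s, A.transcript s x t)))

/-- The set of times at which the stopping condition of the algorithm holds; the algorithm stops at
the first of them. -/
def Algorithm.stopTimes (A : Algorithm n E Z) (s : A.Seed) (x : ℕ → Fin n → Z) : Set ℕ :=
  {t | (s, A.transcript s x t) ∈ A.halt t}

/-- The total number of oracle calls (`⊤` if the algorithm never stops). -/
def Algorithm.numSamples (A : Algorithm n E Z) (s : A.Seed) (x : ℕ → Fin n → Z) : ℕ∞ :=
  ⨅ t ∈ A.stopTimes s x, (t : ℕ∞)

/-- The joint law of the internal randomness and the oracle answers: the answers are independent of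
each other and of the internal randomness, and every answer of oracle `i` has law `P i`. -/
def Algorithm.law (A : Algorithm n E Z) (P : Fin n → ProbabilityMeasure Z) :
    Measure (A.Seed × (ℕ → Fin n → Z)) :=
  (A.seedLaw : Measure A.Seed).prod
    (Measure.infinitePi fun _ : ℕ => Measure.pi fun i => (P i : Measure Z))

/-- The expected number of oracle calls on the data distributions `P`. -/
def Algorithm.expectedSamples (A : Algorithm n E Z) (P : Fin n → ProbabilityMeasure Z) : ENNReal :=
  ∫⁻ ω, (A.numSamples ω.1 ω.2 : ENNReal) ∂(A.law P)

end Algorithm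

/-- The algorithm `A` is an `(ε, δ)`-algorithm on the group DRO problem `(M, P)`: with probability
at least `1 - δ` it stops and returns an `ε`-optimal solution. -/
def Algorithm.Solves {E Z : Type} [NormedAddCommGroup E] [NormedSpace ℝ E] [MeasurableSpace E]
    [MeasurableSpace Z] {n : ℕ} (A : Algorithm n E Z) (M : Model E Z)
    (P : Fin n → ProbabilityMeasure Z) (ε δ : ℝ) : Prop :=
  ENNReal.ofReal (1 - δ) ≤ A.law P {ω | ∃ t, IsLeast (A.stopTimes ω.1 ω.2) t ∧
    M.IsEpsOptimal P ε (A.output t (ω.1, A.transcript ω.1 ω.2 t))}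

end GroupDRO

end

/-! The sum D + n log(min{n, D}/δ) is at most twice its larger term, so two families of problems
suffice, one for each term. Both use the cube [-1/2, 1/2]^d with the sup norm, d = ⌊8D⌋, and losses
1/2 ± θ_j. The Euclidean norm dominates the sup norm, so a multiple of its square is
distance-generating, and the multiple can be tuned to make the radius exactly D.

Averaging over the seed yields one deterministic algorithm that is good on average under a prior
(`Algorithm.exists_deterministic`). With a horizon T, all probabilities become finite sums over the
prefix-free histories in `terminal`, where a history has a product `weight`. Kraft's inequality
`sum_weight_terminal_le_one` is the main tool. It also applies to tilted masses: if a second moment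
of a likelihood ratio is κ per relevant sample, a discount κ⁻¹ on these samples restores total mass
at most one, so the second moment over histories with at most B of them is at most κ^B.

Term D (`le_of_mostly_correct`, Assouad): all groups share a distribution in which coordinate j is
uniform and its sign has mean ±7ε. An ε-optimal θ has the right sign in all but 2/7 of the
coordinates. With few samples of coordinate j, flipping its bias is barely visible, so the sign is
wrong about half the time. Hence most coordinates need order 1/ε² samples.

Term n log(m/δ) (`Blocks.sq_le_of_mostly_correct`): the groups form m ≤ min{n, d} blocks, each
owning a coordinate. A block has at most one special group, whose risk forces the sign of that
coordinate; any other group has risk 1/4 for every θ. The answer in a block always contradicts some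
alternatives for every arm j, so every arm must be sampled enough to rule these out. The prior is
independent over blocks, so the likelihood of a history factorizes, and the total failure δ splits
as a sum over blocks (`sum_prod_erase_mul_sub_le`): an average block may fail only with probability
of order δ/m. A change of measure (`sq_le_of_few_samples`) from the world where block k has no
special group then forces κ^B ≳ m/δ, that is B ≳ log(m/δ)/ε², for most of the n arms. -/

noncomputable section

namespace GroupDRO

/-! ### Finite histories, their product weights, and Kraft's inequality -/

section History

variable {n : ℕ} {Z : Type}

/-- The first `r` entries of a sequence of length `t`. -/
def histPrefix {t : ℕ} (r : Fin t) (h : Fin t → Z) : Fin r → Z :=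
  fun i => h (Fin.castLE r.is_lt.le i)

/-- A finite sequence of received datapoints. -/
abbrev Hist (Z : Type) : Type := Σ t : ℕ, (Fin t → Z)

/-- The oracle called in round `r`, when the oracles are chosen by `q`. -/
def callAt (q : ∀ t, (Fin t → Z) → Fin n) (h : Hist Z) (r : Fin h.1) : Fin n :=
  q r (histPrefix r h.2)

/-- The product of the values of `f` at the rounds of a history. -/
def weight (q : ∀ t, (Fin t → Z) → Fin n) (f : Fin n → Z → ℝ) (h : Hist Z) : ℝ :=
  ∏ r : Fin h.1, f (callAt q h r) (h.2 r)

/-- The number of the rounds of a history in which `p` holds. -/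
def tally (q : ∀ t, (Fin t → Z) → Fin n) (p : Fin n → Z → Prop) (h : Hist Z) : ℕ :=
  by classical exact (Finset.univ.filter fun r : Fin h.1 => p (callAt q h r) (h.2 r)).card

/-- The rule `halt` has not held before the end of the history. -/
def Alive (halt : ∀ t, Set (Fin t → Z)) (h : Hist Z) : Prop :=
  ∀ r : Fin h.1, histPrefix r h.2 ∉ halt r

open Classical in
/-- The histories of length at most `T` at the end of which the rule `halt` holds for the first
time. -/
def terminal [Fintype Z] (halt : ∀ t, Set (Fin t → Z)) (T : ℕ) : Finset (Hist Z) :=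
  (Finset.range (T + 1)).sigma fun t =>
    Finset.univ.filter fun h : Fin t → Z => Alive halt ⟨t, h⟩ ∧ h ∈ halt t

variable {q : ∀ t, (Fin t → Z) → Fin n}

theorem weight_nonneg {f : Fin n → Z → ℝ} (hf : ∀ i z, 0 ≤ f i z) (h : Hist Z) :
    0 ≤ weight q f h :=
  Finset.prod_nonneg fun _ _ => hf _ _

theorem weight_mul (f g : Fin n → Z → ℝ) (h : Hist Z) :
    weight q (fun i z => f i z * g i z) h = weight q f h * weight q g h :=
  Finset.prod_mul_distrib

theorem weight_prod {ι : Type*} (s : Finset ι) (f : ι → Fin n → Z → ℝ) (h : Hist Z) :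
    weight q (fun i z => ∏ k ∈ s, f k i z) h = ∏ k ∈ s, weight q (f k) h :=
  Finset.prod_comm

-- This turns a constant discount per round satisfying `p` into a power, which is how tilted masses
-- record sample counts.
open Classical in
theorem weight_ite (p : Fin n → Z → Prop) (c : ℝ) (h : Hist Z) :
    weight q (fun i z => if p i z then c else 1) h = c ^ tally q p h := by
  unfold weight tally
  rw [Finset.prod_ite]
  simp

theorem histPrefix_castSucc_snoc {t : ℕ} (r : Fin t) (h : Fin t → Z) (z : Z) :
    histPrefix (Z := Z) r.castSucc (Fin.snoc (α := fun _ => Z) h z) = histPrefix r h := by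
  funext i
  have : Fin.castLE r.castSucc.is_lt.le i = Fin.castSucc (Fin.castLE r.is_lt.le i) := rfl
  simp only [histPrefix, this]
  exact Fin.snoc_castSucc (α := fun _ => Z) _ _ _

theorem histPrefix_last_snoc {t : ℕ} (h : Fin t → Z) (z : Z) :
    histPrefix (Z := Z) (Fin.last t) (Fin.snoc (α := fun _ => Z) h z) = h := by
  funext i
  exact Fin.snoc_castSucc (α := fun _ => Z) _ _ _

theorem weight_snoc (f : Fin n → Z → ℝ) (t : ℕ) (h : Fin t → Z) (z : Z) :
    weight q f ⟨t + 1, Fin.snoc (α := fun _ => Z) h z⟩ = weight q f ⟨t, h⟩ * f (q t h) z := by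
  unfold weight callAt
  simp only
  rw [Fin.prod_univ_castSucc, histPrefix_last_snoc]
  simp only [histPrefix_castSucc_snoc, Fin.snoc_castSucc, Fin.snoc_last]
  rfl

theorem alive_snoc (halt : ∀ t, Set (Fin t → Z)) (t : ℕ) (h : Fin t → Z) (z : Z) :
    Alive halt ⟨t + 1, Fin.snoc (α := fun _ => Z) h z⟩ ↔ Alive halt ⟨t, h⟩ ∧ h ∉ halt t := by
  unfold Alive
  simp only
  rw [Fin.forall_fin_succ', histPrefix_last_snoc]
  simp only [histPrefix_castSucc_snoc]
  rfl

theorem sum_tally_le {ι : Type*} (s : Finset ι) (p : ι → Fin n → Z → Prop)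
    (hp : ∀ i z, ∀ a ∈ s, ∀ b ∈ s, p a i z → p b i z → a = b) (h : Hist Z) :
    ∑ a ∈ s, tally q (p a) h ≤ h.1 := by
  classical
  unfold tally
  rw [← Finset.card_biUnion]
  · exact (Finset.card_le_univ _).trans (by simp)
  · intro a ha b hb hab
    rw [Function.onFun, Finset.disjoint_filter]
    intro r _ h1 h2
    exact hab (hp _ _ a ha b hb h1 h2)

variable [Fintype Z]

theorem mem_terminal {halt : ∀ t, Set (Fin t → Z)} {T : ℕ} {h : Hist Z} :
    h ∈ terminal halt T ↔ h.1 ≤ T ∧ Alive halt h ∧ h.2 ∈ halt h.1 := by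
  classical
  unfold terminal
  simp

/-- Kraft's inequality: the terminal histories are prefix-free. -/
theorem sum_weight_terminal_le_one {f : Fin n → Z → ℝ} (hf : ∀ i z, 0 ≤ f i z)
    (hf1 : ∀ i, ∑ z, f i z ≤ 1) (halt : ∀ t, Set (Fin t → Z)) (T : ℕ) :
    ∑ h ∈ terminal halt T, weight q f h ≤ 1 := by
  classical
  -- `U t` is the mass still running on reaching length `t`, and `V t` the part of it that stops
  -- there. One more round cannot create mass, so the stopped masses telescope against `U 0 = 1`.
  let U : ℕ → ℝ := fun t => ∑ h : Fin t → Z, if Alive halt ⟨t, h⟩ then weight q f ⟨t, h⟩ else 0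
  let V : ℕ → ℝ := fun t => ∑ h : Fin t → Z,
    if Alive halt ⟨t, h⟩ ∧ h ∈ halt t then weight q f ⟨t, h⟩ else 0
  have hU0 : U 0 = 1 := by
    simp [U, Alive, weight]
  have hU : ∀ t, U (t + 1) ≤ U t - V t := by
    intro t
    simp only [U, V]
    rw [← (Fin.snocEquiv (fun _ : Fin (t + 1) => Z)).sum_comp, Fintype.sum_prod_type_right,
      ← Finset.sum_sub_distrib]
    refine Finset.sum_le_sum fun h _ => ?_
    have e : ∀ z, (Fin.snocEquiv (fun _ : Fin (t + 1) => Z)) (z, h)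
        = Fin.snoc (α := fun _ => Z) h z := fun z => rfl
    simp only [e, weight_snoc, alive_snoc]
    by_cases h1 : Alive halt ⟨t, h⟩
    · by_cases h2 : h ∈ halt t
      · simp [h1, h2]
      · simp only [h1, h2, not_false_iff, and_self, if_true, and_false, if_false, sub_zero,
          ← Finset.mul_sum]
        exact mul_le_of_le_one_right (weight_nonneg hf _) (hf1 _)
    · simp [h1]
  have hsum : ∀ t, ∑ r ∈ Finset.range t, V r ≤ 1 - U t := by
    intro t
    induction t with
    | zero => simp [hU0]
    | succ t ih =>
      rw [Finset.sum_range_succ]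
      linarith [hU t]
  have hUnn : 0 ≤ U (T + 1) := Finset.sum_nonneg fun h _ => by
    split_ifs
    · exact weight_nonneg hf _
    · exact le_rfl
  have : ∑ h ∈ terminal halt T, weight q f h = ∑ r ∈ Finset.range (T + 1), V r := by
    unfold terminal
    rw [Finset.sum_sigma]
    simp only [V, Finset.sum_filter]
  rw [this]
  linarith [hsum (T + 1)]

end History

/-! ### From the law of an algorithm with a fixed seed to sums over terminal histories -/

section Bridge

variable {E Z : Type} [MeasurableSpace E] [MeasurableSpace Z] {n : ℕ}

/-- The rule for choosing oracles when the internal randomness is `s`. -/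
def Algorithm.seedQuery (A : Algorithm n E Z) (s : A.Seed) (t : ℕ) (h : Fin t → Z) : Fin n :=
  A.query t (s, h)

/-- The stopping rule when the internal randomness is `s`. -/
def Algorithm.seedHalt (A : Algorithm n E Z) (s : A.Seed) (t : ℕ) : Set (Fin t → Z) :=
  {h | (s, h) ∈ A.halt t}

/-- The output when the internal randomness is `s`. -/
def Algorithm.seedOutput (A : Algorithm n E Z) (s : A.Seed) (h : Hist Z) : E :=
  A.output h.1 (s, h.2)

/-- The law of the oracle answers. -/
def answerLaw (P : Fin n → ProbabilityMeasure Z) : Measure (ℕ → Fin n → Z) :=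
  Measure.infinitePi fun _ : ℕ => Measure.pi fun i => (P i : Measure Z)

instance (P : Fin n → ProbabilityMeasure Z) : IsProbabilityMeasure (answerLaw P) := by
  unfold answerLaw; infer_instance

/-- The probability masses of data distributions. -/
def masses (P : Fin n → ProbabilityMeasure Z) (i : Fin n) (z : Z) : ℝ :=
  (P i : Measure Z).real {z}

theorem masses_nonneg (P : Fin n → ProbabilityMeasure Z) (i : Fin n) (z : Z) :
    0 ≤ masses P i z :=
  measureReal_nonneg

theorem Algorithm.histPrefix_transcript (A : Algorithm n E Z) (s : A.Seed) (x : ℕ → Fin n → Z)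
    {t : ℕ} (r : Fin t) : histPrefix r (A.transcript s x t) = A.transcript s x r := by
  induction t with
  | zero => exact r.elim0
  | succ t ih =>
    refine Fin.lastCases ?_ (fun r => ?_) r
    · exact histPrefix_last_snoc _ _
    · exact (histPrefix_castSucc_snoc _ _ _).trans (ih r)

theorem Algorithm.isLeast_stopTimes_iff (A : Algorithm n E Z) (s : A.Seed) (x : ℕ → Fin n → Z)
    (t : ℕ) : IsLeast (A.stopTimes s x) t ↔
      Alive (A.seedHalt s) ⟨t, A.transcript s x t⟩ ∧ A.transcript s x t ∈ A.seedHalt s t := by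
  have h1 : A.transcript s x t ∈ A.seedHalt s t ↔ t ∈ A.stopTimes s x := Iff.rfl
  have h2 : Alive (A.seedHalt s) ⟨t, A.transcript s x t⟩ ↔ ∀ r < t, r ∉ A.stopTimes s x := by
    unfold Alive
    simp only [A.histPrefix_transcript]
    exact ⟨fun h r hr => h ⟨r, hr⟩, fun h r => h r r.2⟩
  rw [h1, h2]
  constructor
  · exact fun h => ⟨fun r hr hr' => absurd (h.2 hr') (not_le.2 hr), h.1⟩
  · exact fun h => ⟨h.2, fun r hr => not_lt.1 fun hlt => h.1 r hlt hr⟩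

theorem Algorithm.numSamples_eq (A : Algorithm n E Z) (s : A.Seed) (x : ℕ → Fin n → Z)
    {t : ℕ} (h : IsLeast (A.stopTimes s x) t) : A.numSamples s x = t := by
  unfold Algorithm.numSamples
  refine le_antisymm (iInf₂_le t h.1) (le_iInf₂ fun r hr => ?_)
  exact_mod_cast h.2 hr

theorem Algorithm.exists_isLeast (A : Algorithm n E Z) (s : A.Seed) (x : ℕ → Fin n → Z)
    {T : ℕ} (h : A.numSamples s x < T) : ∃ t < T, IsLeast (A.stopTimes s x) t := by
  unfold Algorithm.numSamples at h
  simp only [iInf_lt_iff] at h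
  obtain ⟨t, ht, hT⟩ := h
  classical
  have hex : ∃ t, t ∈ A.stopTimes s x := ⟨t, ht⟩
  refine ⟨Nat.find hex, lt_of_le_of_lt (Nat.find_min' hex ht) (by exact_mod_cast hT),
    Nat.find_spec hex, fun r hr => Nat.find_min' hex hr⟩

/-- The event that the datapoints received up to the stopping time are `h`. -/
def Algorithm.stopsAt (A : Algorithm n E Z) (s : A.Seed) (h : Hist Z) : Set (ℕ → Fin n → Z) :=
  {x | A.transcript s x h.1 = h.2}

variable [Fintype Z]

theorem Algorithm.isLeast_of_stopsAt (A : Algorithm n E Z) {s : A.Seed} {T : ℕ} {h : Hist Z}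
    (hh : h ∈ terminal (A.seedHalt s) T) {x : ℕ → Fin n → Z} (hx : x ∈ A.stopsAt s h) :
    IsLeast (A.stopTimes s x) h.1 := by
  rw [A.isLeast_stopTimes_iff]
  have hx' : A.transcript s x h.1 = h.2 := hx
  rw [hx']
  exact (mem_terminal.1 hh).2

theorem Algorithm.pairwiseDisjoint_stopsAt (A : Algorithm n E Z) (s : A.Seed) (T : ℕ) :
    (terminal (A.seedHalt s) T : Set (Hist Z)).PairwiseDisjoint (A.stopsAt s) := by
  intro h hh h' hh' hne
  rw [Function.onFun, Set.disjoint_left]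
  intro x hx hx'
  apply hne
  have h1 := A.isLeast_of_stopsAt hh hx
  have h2 := A.isLeast_of_stopsAt hh' hx'
  have h3 : h.1 = h'.1 := h1.unique h2
  obtain ⟨t, h⟩ := h
  obtain ⟨t', h'⟩ := h'
  obtain rfl : t = t' := h3
  have hx1 : A.transcript s x t = h := hx
  have hx2 : A.transcript s x t = h' := hx'
  rw [← hx1, ← hx2]

variable [MeasurableSingletonClass Z]

/-- For a fixed history the oracle called in each round is determined by its prefix. The event is
therefore a cylinder that constrains one answer per round, and its probability is a product. -/
theorem Algorithm.answerLaw_transcript (A : Algorithm n E Z) (s : A.Seed)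
    (P : Fin n → ProbabilityMeasure Z) (h : Hist Z) :
    MeasurableSet {x | A.transcript s x h.1 = h.2} ∧
    answerLaw P {x | A.transcript s x h.1 = h.2}
      = ENNReal.ofReal (weight (A.seedQuery s) (masses P) h) := by
  obtain ⟨t, h⟩ := h
  have key : ∃ S : ℕ → Set (Fin n → Z), (∀ r, MeasurableSet (S r)) ∧
      {x | A.transcript s x t = h} = (Finset.range t : Set ℕ).pi S ∧
      ∏ r ∈ Finset.range t, (Measure.pi fun i => (P i : Measure Z)) (S r)
        = ENNReal.ofReal (weight (A.seedQuery s) (masses P) ⟨t, h⟩) := by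
    induction t with
    | zero =>
      refine ⟨fun _ => Set.univ, fun _ => MeasurableSet.univ, ?_, ?_⟩
      · ext x
        simp [eq_iff_true_of_subsingleton]
      · simp [weight]
    | succ t ih =>
      obtain ⟨h', z, rfl⟩ : ∃ (h' : Fin t → Z) (z : Z), h = Fin.snoc (α := fun _ => Z) h' z :=
        ⟨Fin.init h, h (Fin.last t), (Fin.snoc_init_self _).symm⟩
      obtain ⟨S, hS, hS1, hS2⟩ := ih h'
      refine ⟨fun r => if r = t then {y | y (A.seedQuery s t h') = z} else S r, ?_, ?_, ?_⟩
      · intro r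
        dsimp only
        split_ifs
        · exact measurableSet_eq_fun (measurable_pi_apply (A.seedQuery s t h')) measurable_const
        · exact hS r
      · ext x
        have e1 : A.transcript s x t = h' ↔ x ∈ (Finset.range t : Set ℕ).pi S := by
          rw [← hS1]; rfl
        have e2 : A.transcript s x (t + 1) = Fin.snoc (α := fun _ => Z) h' z ↔
            A.transcript s x t = h' ∧ x t (A.seedQuery s t h') = z := by
          constructor
          · intro hx
            have h1 : A.transcript s x t = h' := by
              have := congrArg Fin.init hx
              simpa [Algorithm.transcript] using this
            have h2 := congrFun hx (Fin.last t)
            simp only [Algorithm.transcript, Fin.snoc_last, h1] at h2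
            exact ⟨h1, h2⟩
          · rintro ⟨h1, h2⟩
            simp only [Algorithm.transcript, h1]
            exact congrArg _ h2
        simp only [Set.mem_ofPred_eq, e2, e1, Set.mem_pi, Finset.coe_range, Set.mem_Iio]
        constructor
        · rintro ⟨h1, h2⟩ r hr
          split_ifs with hrt
          · subst hrt; exact h2
          · exact h1 r (by omega)
        · intro hx
          refine ⟨fun r hr => ?_, ?_⟩
          · have := hx r (by omega)
            rwa [if_neg (by omega)] at this
          · have := hx t (by omega)
            rwa [if_pos rfl] at this
      · rw [Finset.prod_range_succ, weight_snoc,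
          ENNReal.ofReal_mul (weight_nonneg (masses_nonneg P) _), ← hS2]
        congr 1
        · refine Finset.prod_congr rfl fun r hr => ?_
          dsimp only
          rw [if_neg (Finset.mem_range.1 hr).ne]
        · dsimp only
          rw [if_pos rfl]
          have e := (measurePreserving_eval (fun i => (P i : Measure Z))
            (A.seedQuery s t h')).measure_preimage (measurableSet_singleton z).nullMeasurableSet
          refine Eq.trans e ?_
          simp [masses, Measure.real]
  obtain ⟨S, hS, hS1, hS2⟩ := key
  simp only [hS1]
  refine ⟨MeasurableSet.pi (Finset.countable_toSet _) fun r _ => hS r, ?_⟩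
  rw [answerLaw, Measure.infinitePi_pi _ fun r _ => hS r, hS2]

theorem Algorithm.answerLaw_biUnion_stopsAt (A : Algorithm n E Z) (s : A.Seed) (T : ℕ)
    (P : Fin n → ProbabilityMeasure Z) (H : Finset (Hist Z))
    (hH : H ⊆ terminal (A.seedHalt s) T) :
    answerLaw P (⋃ h ∈ H, A.stopsAt s h)
      = ENNReal.ofReal (∑ h ∈ H, weight (A.seedQuery s) (masses P) h) := by
  rw [measure_biUnion_finset ((A.pairwiseDisjoint_stopsAt s T).subset hH)
    fun h _ => (A.answerLaw_transcript s P h).1,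
    ENNReal.ofReal_sum_of_nonneg fun h _ => weight_nonneg (masses_nonneg P) _]
  exact Finset.sum_congr rfl fun h _ => (A.answerLaw_transcript s P h).2

/-- The expected number of samples when the internal randomness is `s`. -/
def Algorithm.seedSamples (A : Algorithm n E Z) (P : Fin n → ProbabilityMeasure Z)
    (s : A.Seed) : ENNReal :=
  ∫⁻ x, (A.numSamples s x : ENNReal) ∂(answerLaw P)

/-- Terminal histories correspond to disjoint events on which the number of samples is the length;
runs longer than `T` are dropped. -/
theorem Algorithm.sum_weight_mul_length_le (A : Algorithm n E Z) (s : A.Seed) (T : ℕ)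
    (P : Fin n → ProbabilityMeasure Z) :
    ENNReal.ofReal (∑ h ∈ terminal (A.seedHalt s) T,
      weight (A.seedQuery s) (masses P) h * h.1) ≤ A.seedSamples P s := by
  classical
  have hm : ∀ h : Hist Z, MeasurableSet (A.stopsAt s h) :=
    fun h => (A.answerLaw_transcript s P h).1
  calc _ = ∑ h ∈ terminal (A.seedHalt s) T, (h.1 : ENNReal) * answerLaw P (A.stopsAt s h) := by
        rw [ENNReal.ofReal_sum_of_nonneg fun h _ =>
          mul_nonneg (weight_nonneg (masses_nonneg P) _) (Nat.cast_nonneg _)]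
        refine Finset.sum_congr rfl fun h _ => ?_
        rw [ENNReal.ofReal_mul (weight_nonneg (masses_nonneg P) _), mul_comm,
          ENNReal.ofReal_natCast]
        exact congrArg _ (A.answerLaw_transcript s P h).2.symm
    _ = ∫⁻ x, ∑ h ∈ terminal (A.seedHalt s) T,
          (A.stopsAt s h).indicator (fun _ => (h.1 : ENNReal)) x ∂(answerLaw P) := by
        rw [lintegral_finsetSum _ fun h _ => measurable_const.indicator (hm h)]
        refine Finset.sum_congr rfl fun h _ => ?_
        rw [lintegral_indicator (hm h)]
        simp
    _ ≤ _ := by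
        refine lintegral_mono fun x => ?_
        by_cases hx : ∃ h ∈ terminal (A.seedHalt s) T, x ∈ A.stopsAt s h
        · obtain ⟨h, hh, hx⟩ := hx
          rw [Finset.sum_eq_single_of_mem h hh]
          · rw [Set.indicator_of_mem hx, A.numSamples_eq s x (A.isLeast_of_stopsAt hh hx)]
            simp
          · intro h' hh' hne
            refine Set.indicator_of_notMem (fun hx' => ?_) _
            exact Set.disjoint_left.1 (A.pairwiseDisjoint_stopsAt s T hh' hh hne) hx' hx
        · push Not at hx
          rw [Finset.sum_eq_zero fun h hh => Set.indicator_of_notMem (hx h hh) _]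
          exact zero_le

/-- Markov's inequality: a run that does not stop by time `T` draws at least `T` samples. This makes
the mass lost to the horizon as small as desired. -/
theorem Algorithm.sum_weight_terminal_ge (A : Algorithm n E Z) (s : A.Seed) (T : ℕ)
    (P : Fin n → ProbabilityMeasure Z) :
    T * (1 - ENNReal.ofReal (∑ h ∈ terminal (A.seedHalt s) T,
      weight (A.seedQuery s) (masses P) h)) ≤ A.seedSamples P s := by
  have hm : MeasurableSet (⋃ h ∈ terminal (A.seedHalt s) T, A.stopsAt s h) :=
    Finset.measurableSet_biUnion _ fun h _ => (A.answerLaw_transcript s P h).1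
  rw [← A.answerLaw_biUnion_stopsAt s T P _ subset_rfl, ← prob_compl_eq_one_sub hm]
  calc _ = ∫⁻ x, (⋃ h ∈ terminal (A.seedHalt s) T, A.stopsAt s h)ᶜ.indicator
        (fun _ => (T : ENNReal)) x ∂(answerLaw P) := by
        rw [lintegral_indicator hm.compl]; simp
    _ ≤ _ := by
        refine lintegral_mono fun x => ?_
        by_cases hx : x ∈ (⋃ h ∈ terminal (A.seedHalt s) T, A.stopsAt s h)
        · rw [Set.indicator_of_notMem (by simpa using hx)]
          exact zero_le
        · rw [Set.indicator_of_mem hx]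
          by_contra hlt
          rw [not_le] at hlt
          have : A.numSamples s x < T := by
            have h1 : ((A.numSamples s x : ℕ∞) : ENNReal) < ((T : ℕ∞) : ENNReal) := by
              simpa using hlt
            exact ENat.toENNReal_lt.1 h1
          obtain ⟨t, ht, hl⟩ := A.exists_isLeast s x this
          apply hx
          simp only [Set.mem_iUnion]
          exact ⟨⟨t, A.transcript s x t⟩,
            mem_terminal.2 ⟨ht.le, (A.isLeast_stopTimes_iff s x t).1 hl⟩, rfl⟩

open Classical in
theorem Algorithm.sum_weight_fail_le (A : Algorithm n E Z) (s : A.Seed) (T : ℕ)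
    (P : Fin n → ProbabilityMeasure Z) (good : Set E) :
    ENNReal.ofReal (∑ h ∈ (terminal (A.seedHalt s) T).filter fun h => A.seedOutput s h ∉ good,
      weight (A.seedQuery s) (masses P) h) ≤
    answerLaw P {x | ∃ t, IsLeast (A.stopTimes s x) t ∧
      A.output t (s, A.transcript s x t) ∈ good}ᶜ := by
  rw [← A.answerLaw_biUnion_stopsAt s T P _ (Finset.filter_subset _ _)]
  refine measure_mono fun x hx => ?_
  simp only [Set.mem_iUnion, Finset.mem_filter] at hx
  obtain ⟨h, ⟨hh, hg⟩, hx⟩ := hx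
  rintro ⟨t, ht, ht2⟩
  obtain rfl : t = h.1 := ht.unique (A.isLeast_of_stopsAt hh hx)
  have hx' : A.transcript s x h.1 = h.2 := hx
  rw [hx'] at ht2
  exact hg ht2

end Bridge

/-! ### Measurability, and the choice of one seed -/

section Derandomization

variable {E Z : Type} [MeasurableSpace E] [MeasurableSpace Z] {n : ℕ}

theorem Algorithm.measurable_transcript (A : Algorithm n E Z) (t : ℕ) :
    Measurable fun ω : A.Seed × (ℕ → Fin n → Z) => A.transcript ω.1 ω.2 t := by
  induction t with
  | zero => exact measurable_pi_iff.2 fun i => i.elim0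
  | succ t ih =>
    refine measurable_pi_iff.2 fun i => ?_
    refine Fin.lastCases ?_ (fun r => ?_) i
    · simp only [Algorithm.transcript, Fin.snoc_last]
      have h1 : Measurable fun p : Fin n × (Fin n → Z) => p.2 p.1 :=
        measurable_from_prod_countable_right fun i => measurable_pi_apply i
      have h2 : Measurable fun ω : A.Seed × (ℕ → Fin n → Z) =>
          A.query t (ω.1, A.transcript ω.1 ω.2 t) :=
        (A.measurable_query t).comp (measurable_fst.prodMk ih)
      have h3 : Measurable fun ω : A.Seed × (ℕ → Fin n → Z) => ω.2 t :=
        (measurable_pi_apply t).comp measurable_snd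
      exact h1.comp (h2.prodMk h3)
    · simp only [Algorithm.transcript, Fin.snoc_castSucc]
      exact (measurable_pi_apply r).comp ih

theorem Algorithm.measurableSet_isLeast (A : Algorithm n E Z) (t : ℕ) :
    MeasurableSet {ω : A.Seed × (ℕ → Fin n → Z) | IsLeast (A.stopTimes ω.1 ω.2) t} := by
  have h1 : ∀ t, MeasurableSet {ω : A.Seed × (ℕ → Fin n → Z) | t ∈ A.stopTimes ω.1 ω.2} :=
    fun t => (measurable_fst.prodMk (A.measurable_transcript t)) (A.measurableSet_halt t)
  have : {ω : A.Seed × (ℕ → Fin n → Z) | IsLeast (A.stopTimes ω.1 ω.2) t}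
      = {ω | t ∈ A.stopTimes ω.1 ω.2} ∩ ⋂ r ∈ Finset.range t, {ω | r ∈ A.stopTimes ω.1 ω.2}ᶜ := by
    ext ω
    simp only [IsLeast, lowerBounds, Set.mem_ofPred_eq, Set.mem_inter_iff, Set.mem_iInter,
      Finset.mem_range, Set.mem_compl_iff]
    exact and_congr_right fun _ => ⟨fun h r hr hr' => absurd (h hr') (not_le.2 hr),
      fun h r hr => not_lt.1 fun hlt => h r hlt hr⟩
  rw [this]
  exact (h1 t).inter (Finset.measurableSet_biInter _ fun r _ => (h1 r).compl)

theorem Algorithm.measurable_numSamples (A : Algorithm n E Z) :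
    Measurable fun ω : A.Seed × (ℕ → Fin n → Z) => (A.numSamples ω.1 ω.2 : ENNReal) := by
  refine (Measurable.of_discrete (f := ENat.toENNReal)).comp (ENat.measurable_iff.2 fun k => ?_)
  convert A.measurableSet_isLeast k using 1
  ext ω
  constructor
  · intro h
    have h' : A.numSamples ω.1 ω.2 = k := h
    obtain ⟨t, -, ht⟩ := A.exists_isLeast ω.1 ω.2 (T := k + 1)
      (by rw [h']; exact_mod_cast k.lt_succ_self)
    have := A.numSamples_eq _ _ ht
    rw [h'] at this
    obtain rfl : k = t := by exact_mod_cast this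
    exact ht
  · exact fun h => A.numSamples_eq _ _ h

/-- The event that the algorithm stops with an output in `good`. -/
def Algorithm.returns (A : Algorithm n E Z) (good : Set E) : Set (A.Seed × (ℕ → Fin n → Z)) :=
  {ω | ∃ t, IsLeast (A.stopTimes ω.1 ω.2) t ∧ A.output t (ω.1, A.transcript ω.1 ω.2 t) ∈ good}

theorem Algorithm.measurableSet_returns (A : Algorithm n E Z) {good : Set E}
    (hg : MeasurableSet good) : MeasurableSet (A.returns good) := by
  have : A.returns good = ⋃ t, {ω | IsLeast (A.stopTimes ω.1 ω.2) t} ∩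
      (fun ω => A.output t (ω.1, A.transcript ω.1 ω.2 t)) ⁻¹' good := by
    ext ω
    simp [Algorithm.returns]
  rw [this]
  exact MeasurableSet.iUnion fun t => (A.measurableSet_isLeast t).inter
    (((A.measurable_output t).comp (measurable_fst.prodMk (A.measurable_transcript t))) hg)

variable [Fintype Z] [MeasurableSingletonClass Z]

open Classical in
/-- If an algorithm performs well on each problem of a finite family then, for any prior on the
family, some deterministic algorithm performs well on average. -/
theorem Algorithm.exists_deterministic {ι : Type*} [Fintype ι] (A : Algorithm n E Z)
    (P : ι → Fin n → ProbabilityMeasure Z) (prior : ι → ℝ) (hpos : ∀ c, 0 < prior c)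
    (hsum : ∑ c, prior c = 1) (good : ι → Set E) (hgood : ∀ c, MeasurableSet (good c))
    {δ B : ℝ} (hδ : 0 < δ) (hδ1 : δ < 1) (hB : 0 < B)
    (hsolve : ∀ c, ENNReal.ofReal (1 - δ) ≤ A.law (P c) (A.returns (good c)))
    (hsamples : ∀ c, A.expectedSamples (P c) ≤ ENNReal.ofReal B) :
    ∃ (q : ∀ t, (Fin t → Z) → Fin n) (halt : ∀ t, Set (Fin t → Z)) (out : Hist Z → E),
      ∀ η > 0, ∃ T : ℕ,
        (∀ c, 1 - η ≤ ∑ h ∈ terminal halt T, weight q (masses (P c)) h) ∧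
        ∑ c, prior c * ∑ h ∈ terminal halt T, weight q (masses (P c)) h * h.1 ≤ 101 * B ∧
        ∑ c, prior c * ∑ h ∈ (terminal halt T).filter fun h => out h ∉ good c,
          weight q (masses (P c)) h ≤ 101 / 100 * δ := by
  have hlaw : ∀ c, A.law (P c) = (A.seedLaw : Measure A.Seed).prod (answerLaw (P c)) :=
    fun c => rfl
  let fail : ι → A.Seed → ENNReal := fun c s =>
    answerLaw (P c) (Prod.mk s ⁻¹' (A.returns (good c))ᶜ)
  have hfm : ∀ c, Measurable (fail c) := fun c =>
    measurable_measure_prodMk_left (A.measurableSet_returns (hgood c)).compl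
  have hnm : ∀ c, Measurable (A.seedSamples (P c)) := fun c =>
    A.measurable_numSamples.lintegral_prod_right'
  have hfail : ∀ c, ∫⁻ s, fail c s ∂(A.seedLaw : Measure A.Seed) ≤ ENNReal.ofReal δ := by
    intro c
    have h1 := A.measurableSet_returns (hgood c)
    have : IsProbabilityMeasure (A.law (P c)) := by rw [hlaw]; infer_instance
    have h2 : ∫⁻ s, fail c s ∂(A.seedLaw : Measure A.Seed) = A.law (P c) (A.returns (good c))ᶜ := by
      rw [hlaw, Measure.prod_apply h1.compl]
    rw [h2, prob_compl_eq_one_sub h1]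
    calc _ ≤ 1 - ENNReal.ofReal (1 - δ) := tsub_le_tsub_left (hsolve c) _
      _ = ENNReal.ofReal δ := by
        rw [← ENNReal.ofReal_one, ← ENNReal.ofReal_sub _ (by linarith)]
        congr 1; ring
  have hns : ∀ c, ∫⁻ s, A.seedSamples (P c) s ∂(A.seedLaw : Measure A.Seed)
      ≤ ENNReal.ofReal B := by
    intro c
    refine le_trans (le_of_eq ?_) (hsamples c)
    rw [Algorithm.expectedSamples, hlaw, lintegral_prod _ A.measurable_numSamples.aemeasurable]
    rfl
  -- One seed must control both failure and cost. The uneven weights 100 and 1 inflate the failure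
  -- probability by only 1%, which matters because δ may be close to 1/8, at the price of a factor
  -- 101 in the cost.
  let F : A.Seed → ENNReal := fun s => ∑ c, ENNReal.ofReal (prior c) *
    (ENNReal.ofReal (100 / δ) * fail c s + ENNReal.ofReal (1 / B) * A.seedSamples (P c) s)
  have hGm : ∀ c, Measurable fun s => ENNReal.ofReal (100 / δ) * fail c s
      + ENNReal.ofReal (1 / B) * A.seedSamples (P c) s := fun c =>
    ((hfm c).const_mul _).add ((hnm c).const_mul _)
  have hFm : Measurable F := Finset.measurable_sum _ fun c _ => (hGm c).const_mul _
  have hF : ∫⁻ s, F s ∂(A.seedLaw : Measure A.Seed) ≤ ENNReal.ofReal 101 := by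
    simp only [F]
    rw [lintegral_finsetSum _ fun c _ => (hGm c).const_mul _]
    calc _ ≤ ∑ c, ENNReal.ofReal (prior c) * ENNReal.ofReal 101 := by
          refine Finset.sum_le_sum fun c _ => ?_
          rw [lintegral_const_mul _ (hGm c),
            lintegral_add_left ((hfm c).const_mul _), lintegral_const_mul _ (hfm c),
            lintegral_const_mul _ (hnm c)]
          gcongr
          calc _ ≤ ENNReal.ofReal (100 / δ) * ENNReal.ofReal δ
                + ENNReal.ofReal (1 / B) * ENNReal.ofReal B := by
                gcongr
                · exact hfail c
                · exact hns c
            _ = ENNReal.ofReal 101 := by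
                rw [← ENNReal.ofReal_mul (by positivity), ← ENNReal.ofReal_mul (by positivity),
                  ← ENNReal.ofReal_add (by positivity) (by positivity)]
                congr 1
                field_simp
                norm_num
      _ = ENNReal.ofReal 101 := by
          rw [← Finset.sum_mul, ← ENNReal.ofReal_sum_of_nonneg fun c _ => (hpos c).le, hsum]
          simp
  obtain ⟨s, hs⟩ := exists_le_lintegral (μ := (A.seedLaw : Measure A.Seed)) hFm.aemeasurable
  replace hs := hs.trans hF
  have hs1 : ∑ c, ENNReal.ofReal (prior c) * fail c s ≤ ENNReal.ofReal (101 / 100 * δ) := by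
    have h1 : ENNReal.ofReal (100 / δ) * ∑ c, ENNReal.ofReal (prior c) * fail c s
        ≤ ENNReal.ofReal 101 := by
      refine le_trans ?_ hs
      rw [Finset.mul_sum]
      refine Finset.sum_le_sum fun c _ => ?_
      rw [mul_left_comm]
      gcongr
      exact le_self_add
    calc _ = ENNReal.ofReal (δ / 100) *
          (ENNReal.ofReal (100 / δ) * ∑ c, ENNReal.ofReal (prior c) * fail c s) := by
          rw [← mul_assoc, ← ENNReal.ofReal_mul (by positivity)]
          have : δ / 100 * (100 / δ) = 1 := by field_simp
          rw [this]; simp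
      _ ≤ ENNReal.ofReal (δ / 100) * ENNReal.ofReal 101 := by gcongr
      _ = _ := by
          rw [← ENNReal.ofReal_mul (by positivity)]
          congr 1; ring
  have hs2 : ∑ c, ENNReal.ofReal (prior c) * A.seedSamples (P c) s
      ≤ ENNReal.ofReal (101 * B) := by
    have h1 : ENNReal.ofReal (1 / B) * ∑ c, ENNReal.ofReal (prior c) * A.seedSamples (P c) s
        ≤ ENNReal.ofReal 101 := by
      refine le_trans ?_ hs
      rw [Finset.mul_sum]
      refine Finset.sum_le_sum fun c _ => ?_
      rw [mul_left_comm]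
      gcongr
      exact le_add_self
    calc _ = ENNReal.ofReal B *
          (ENNReal.ofReal (1 / B) * ∑ c, ENNReal.ofReal (prior c) * A.seedSamples (P c) s) := by
          rw [← mul_assoc, ← ENNReal.ofReal_mul (by positivity)]
          have : B * (1 / B) = 1 := by field_simp
          rw [this]; simp
      _ ≤ ENNReal.ofReal B * ENNReal.ofReal 101 := by gcongr
      _ = _ := by
          rw [← ENNReal.ofReal_mul (by positivity)]
          congr 1; ring
  refine ⟨A.seedQuery s, A.seedHalt s, A.seedOutput s, fun η hη => ?_⟩
  -- Since every problem has positive prior mass, the averaged bound makes each expected cost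
  -- finite, and one horizon serves the whole finite family.
  have hbound : ∃ T : ℕ, 0 < T ∧ ∀ c, A.seedSamples (P c) s ≤ ENNReal.ofReal (T * η) := by
    have hfin : ∀ c, A.seedSamples (P c) s ≠ ⊤ := by
      intro c hc
      have := (Finset.single_le_sum (f := fun c => ENNReal.ofReal (prior c) *
        A.seedSamples (P c) s) (fun _ _ => zero_le) (Finset.mem_univ c)).trans hs2
      rw [hc, ENNReal.mul_top (by simpa using hpos c), top_le_iff] at this
      exact ENNReal.ofReal_ne_top this
    obtain ⟨T, hT⟩ := exists_nat_ge ((∑ c, (A.seedSamples (P c) s).toReal) / η)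
    refine ⟨T + 1, Nat.succ_pos _, fun c => ?_⟩
    rw [← ENNReal.ofReal_toReal (hfin c)]
    apply ENNReal.ofReal_le_ofReal
    have h1 := Finset.single_le_sum (f := fun c => (A.seedSamples (P c) s).toReal)
      (fun _ _ => ENNReal.toReal_nonneg) (Finset.mem_univ c)
    rw [div_le_iff₀ hη] at hT
    push_cast
    nlinarith
  obtain ⟨T, hT, hTη⟩ := hbound
  refine ⟨T, fun c => ?_, ?_, ?_⟩
  · have h1 := (A.sum_weight_terminal_ge s T (P c)).trans (hTη c)
    rw [ENNReal.ofReal_mul (by positivity), ENNReal.ofReal_natCast] at h1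
    rw [ENNReal.mul_le_mul_iff_right (by exact_mod_cast hT.ne') (by simp),
      tsub_le_iff_right, ← ENNReal.ofReal_add hη.le
        (Finset.sum_nonneg fun h _ => weight_nonneg (masses_nonneg _) _),
      ← ENNReal.ofReal_one] at h1
    have h2 := (ENNReal.ofReal_le_ofReal_iff (add_nonneg hη.le
        (Finset.sum_nonneg fun h _ => weight_nonneg (masses_nonneg _) _))).1 h1
    linarith
  · rw [← ENNReal.ofReal_le_ofReal_iff (by positivity)]
    refine le_trans ?_ hs2
    rw [ENNReal.ofReal_sum_of_nonneg fun c _ => mul_nonneg (hpos c).le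
      (Finset.sum_nonneg fun h _ => mul_nonneg (weight_nonneg (masses_nonneg _) _)
        (Nat.cast_nonneg _))]
    refine Finset.sum_le_sum fun c _ => ?_
    rw [ENNReal.ofReal_mul (hpos c).le]
    gcongr
    exact A.sum_weight_mul_length_le s T (P c)
  · rw [← ENNReal.ofReal_le_ofReal_iff (by positivity)]
    refine le_trans ?_ hs1
    rw [ENNReal.ofReal_sum_of_nonneg fun c _ => mul_nonneg (hpos c).le
      (Finset.sum_nonneg fun h _ => weight_nonneg (masses_nonneg _) _)]
    refine Finset.sum_le_sum fun c _ => ?_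
    rw [ENNReal.ofReal_mul (hpos c).le]
    gcongr
    exact A.sum_weight_fail_le s T (P c) (good c)

end Derandomization

/-! ### The cube, its losses and its distance-generating functions -/

section Cube

variable {d : ℕ}

instance : MeasurableSpace (Option (Fin d × Bool)) := ⊤

instance : DiscreteMeasurableSpace (Option (Fin d × Bool)) := ⟨fun _ => trivial⟩

/-- The sign `1` or `-1` encoded by a Boolean. -/
def sgn (s : Bool) : ℝ := if s then 1 else -1

@[simp] theorem sgn_true : sgn true = 1 := rfl

@[simp] theorem sgn_false : sgn false = -1 := rfl

theorem abs_sgn (s : Bool) : |sgn s| = 1 := by cases s <;> simp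

/-- The loss of the datapoint `(j, s)` is `1 / 2 ± θ j`, that of the datapoint `none` is `0`. -/
def cubeLoss (θ : Fin d → ℝ) : Option (Fin d × Bool) → ℝ
  | none => 0
  | some (j, s) => 1 / 2 + sgn s * θ j

/-- The cube of side length `1` centered at `0`. -/
def cube (d : ℕ) : Set (Fin d → ℝ) := Set.Icc (fun _ => -(1 / 2)) fun _ => 1 / 2

theorem mem_cube {θ : Fin d → ℝ} : θ ∈ cube d ↔ ∀ j, -(1 / 2) ≤ θ j ∧ θ j ≤ 1 / 2 := by
  simp only [cube, Set.mem_Icc, Pi.le_def]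
  exact forall_and.symm

theorem mul_sgn_mem_cube (v : Fin d → Bool) : (fun j => -(sgn (v j) / 2)) ∈ cube d := by
  rw [mem_cube]
  intro j
  cases v j <;> norm_num

theorem sgn_mul_add_half_nonneg {θ : Fin d → ℝ} (hθ : θ ∈ cube d) (s : Bool) (j : Fin d) :
    0 ≤ sgn s * θ j + 1 / 2 := by
  have := mem_cube.1 hθ j
  cases s <;> simp <;> linarith

/-- The cube with the losses `cubeLoss`. -/
def cubeModel (d : ℕ) : Model (Fin d → ℝ) (Option (Fin d × Bool)) where
  Θ := cube d
  loss := cubeLoss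
  nonempty_params := ⟨0, mem_cube.2 fun j => by norm_num⟩
  convex_params := convex_Icc _ _
  compact_params := isCompact_Icc
  measurable_loss := fun _ _ => Measurable.of_discrete
  loss_mem := by
    rintro θ hθ (_ | ⟨j, s⟩)
    · simp [cubeLoss]
    · have := mem_cube.1 hθ j
      cases s <;> simp [cubeLoss] <;> constructor <;> linarith
  convex_loss := by
    rintro (_ | ⟨j, s⟩)
    · exact convexOn_const _ (convex_Icc _ _)
    · refine ⟨convex_Icc _ _, fun x _ y _ a b _ _ hab => le_of_eq ?_⟩
      simp only [cubeLoss, Pi.add_apply, Pi.smul_apply, smul_eq_mul]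
      obtain rfl : b = 1 - a := by linarith
      ring

theorem cubeModel_isOneSmooth (d : ℕ) : (cubeModel d).IsOneSmooth := by
  rintro (_ | ⟨j, s⟩) θ -
  · exact ⟨0, hasFDerivWithinAt_const _ _ _, by simp⟩
  · refine ⟨sgn s • ContinuousLinearMap.proj (R := ℝ) (φ := fun _ : Fin d => ℝ) j, ?_, ?_⟩
    · have h1 : HasFDerivAt (fun θ' : Fin d → ℝ => θ' j)
          (ContinuousLinearMap.proj (R := ℝ) (φ := fun _ : Fin d => ℝ) j) θ :=
        hasFDerivAt_apply j θ
      exact ((h1.const_mul (sgn s)).const_add (1 / 2)).hasFDerivWithinAt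
    · refine ContinuousLinearMap.opNorm_le_bound _ zero_le_one fun x => ?_
      simp only [smul_apply, ContinuousLinearMap.proj_apply, smul_eq_mul,
        Real.norm_eq_abs, abs_mul, abs_sgn, one_mul]
      exact norm_le_pi_norm x j

theorem diam_cube (hd : 0 < d) : Metric.diam (cube d) = 1 := by
  apply le_antisymm
  · refine Metric.diam_le_of_forall_dist_le zero_le_one fun x hx y hy => ?_
    rw [dist_pi_le_iff zero_le_one]
    intro j
    have h1 := mem_cube.1 hx j
    have h2 := mem_cube.1 hy j
    rw [Real.dist_eq, abs_le]
    constructor <;> linarith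
  · have h1 : dist (fun _ : Fin d => (-(1 / 2) : ℝ)) (fun _ => 1 / 2) ≤ Metric.diam (cube d) :=
      Metric.dist_le_diam_of_mem (cubeModel d).compact_params.isBounded
        (mem_cube.2 fun _ => by norm_num) (mem_cube.2 fun _ => by norm_num)
    refine le_trans ?_ h1
    refine le_trans ?_ (dist_le_pi_dist _ _ ⟨0, hd⟩)
    rw [Real.dist_eq]
    norm_num

/-- A multiple of the squared Euclidean norm. -/
def quadratic (d : ℕ) (c : ℝ) (θ : Fin d → ℝ) : ℝ := c / 2 * ∑ j, θ j ^ 2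

/-- The derivative of `quadratic`. -/
def quadraticDeriv (d : ℕ) (c : ℝ) (θ : Fin d → ℝ) : StrongDual ℝ (Fin d → ℝ) :=
  c • ∑ j, θ j • ContinuousLinearMap.proj (R := ℝ) (φ := fun _ : Fin d => ℝ) j

theorem quadraticDeriv_apply (c : ℝ) (θ u : Fin d → ℝ) :
    quadraticDeriv d c θ u = c * ∑ j, θ j * u j := by
  simp [quadraticDeriv]

theorem quadraticDeriv_mem {c : ℝ} (hc : 0 ≤ c) (θ : Fin d → ℝ) :
    quadraticDeriv d c θ ∈ subdifferential (cube d) (quadratic d c) θ := by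
  intro u _
  rw [quadraticDeriv_apply, quadratic, quadratic]
  have : 0 ≤ c / 2 * ∑ j, (u j - θ j) ^ 2 := by positivity
  have h2 : ∑ j, (u j - θ j) ^ 2 = ∑ j, u j ^ 2 - ∑ j, θ j ^ 2 - 2 * ∑ j, θ j * (u - θ) j := by
    rw [Finset.mul_sum, ← Finset.sum_sub_distrib, ← Finset.sum_sub_distrib]
    refine Finset.sum_congr rfl fun j _ => ?_
    simp only [Pi.sub_apply]
    ring
  rw [h2] at this
  nlinarith

theorem proxDomain_quadratic {c : ℝ} (hc : 0 ≤ c) :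
    proxDomain (cube d) (quadratic d c) = cube d := by
  ext θ
  exact ⟨fun h => h.1, fun h => ⟨h, _, quadraticDeriv_mem hc θ⟩⟩

/-- The Euclidean square satisfies the parallelogram-type identity exactly, and the sup norm is at
most the Euclidean norm; so `c ≥ 1` is enough for modulus 1. -/
theorem isDistanceGenerating_quadratic {c : ℝ} (hc : 1 ≤ c) :
    IsDistanceGenerating (cube d) (quadratic d c) (quadraticDeriv d c) where
  continuousOn := by
    unfold quadratic
    fun_prop
  strongConvexOn := by
    refine ⟨convex_Icc _ _, fun x _ y _ a b ha hb hab => ?_⟩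
    have hnorm : ‖x - y‖ ^ 2 ≤ ∑ j, (x j - y j) ^ 2 := by
      have h0 : 0 ≤ ∑ j, (x j - y j) ^ 2 := Finset.sum_nonneg fun _ _ => sq_nonneg _
      refine Real.le_sqrt (norm_nonneg _) h0 |>.1 ?_
      rw [pi_norm_le_iff_of_nonneg (Real.sqrt_nonneg _)]
      intro j
      rw [Real.norm_eq_abs]
      apply Real.abs_le_sqrt
      exact Finset.single_le_sum (f := fun j => (x j - y j) ^ 2) (fun _ _ => sq_nonneg _)
        (Finset.mem_univ j)
    have hsum : ∑ j, (a • x + b • y) j ^ 2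
        = a * ∑ j, x j ^ 2 + b * ∑ j, y j ^ 2 - a * b * ∑ j, (x j - y j) ^ 2 := by
      rw [Finset.mul_sum, Finset.mul_sum, Finset.mul_sum, ← Finset.sum_add_distrib,
        ← Finset.sum_sub_distrib]
      refine Finset.sum_congr rfl fun j _ => ?_
      simp only [Pi.add_apply, Pi.smul_apply, smul_eq_mul]
      obtain rfl : b = 1 - a := by linarith
      ring
    simp only [quadratic, hsum, smul_eq_mul]
    have h1 : 0 ≤ a * b := mul_nonneg ha hb
    have h2 : a * b * ‖x - y‖ ^ 2 ≤ c * (a * b * ∑ j, (x j - y j) ^ 2) := by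
      calc a * b * ‖x - y‖ ^ 2 ≤ 1 * (a * b * ∑ j, (x j - y j) ^ 2) := by
            rw [one_mul]; gcongr
        _ ≤ _ := by gcongr
    nlinarith
  nonempty_proxDomain := by
    rw [proxDomain_quadratic (by linarith)]
    exact (cubeModel d).nonempty_params
  selection := fun θ _ => quadraticDeriv_mem (by linarith) θ
  continuousOn_selection := by
    unfold quadraticDeriv
    fun_prop

/-- The center is the origin and the farthest points are the vertices, at squared Euclidean distance
d/4. -/
theorem isBregmanRadius_quadratic {c : ℝ} (hc : 0 ≤ c) :
    IsBregmanRadius (cube d) (quadratic d c) (quadraticDeriv d c) (c * d / 8) := by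
  have h0 : (0 : Fin d → ℝ) ∈ cube d := mem_cube.2 fun j => by norm_num
  have hb : ∀ u, bregman (quadratic d c) (quadraticDeriv d c) 0 u = c / 2 * ∑ j, u j ^ 2 := by
    intro u
    simp [bregman, quadraticDeriv_apply, quadratic]
  refine ⟨0, ⟨?_, ?_⟩, ⟨fun _ => 1 / 2, mem_cube.2 fun j => by norm_num, ?_⟩, ?_⟩
  · rw [proxDomain_quadratic hc]; exact h0
  · intro θ _
    simp only [Set.mem_ofPred_eq, quadratic, Pi.zero_apply]
    have : 0 ≤ c / 2 * ∑ j, θ j ^ 2 := by positivity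
    simpa using this
  · rw [hb]
    simp
    ring
  · rintro _ ⟨u, hu, rfl⟩
    rw [hb]
    have : ∑ j, u j ^ 2 ≤ ∑ _j : Fin d, (1 / 4 : ℝ) := Finset.sum_le_sum fun j _ => by
      have := mem_cube.1 hu j
      nlinarith
    have h3 : c / 2 * ∑ j, u j ^ 2 ≤ c / 2 * ∑ _j : Fin d, (1 / 4 : ℝ) := by gcongr
    refine h3.trans (le_of_eq ?_)
    simp
    ring

/-- The probability measure on a finite space with given masses. -/
def finiteProb {Z : Type} [Fintype Z] [MeasurableSpace Z] (f : Z → ℝ) (hf : ∀ z, 0 ≤ f z)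
    (hf1 : ∑ z, f z = 1) : ProbabilityMeasure Z :=
  ⟨(PMF.ofFintype (fun z => ENNReal.ofReal (f z)) (by
    rw [← ENNReal.ofReal_sum_of_nonneg fun z _ => hf z, hf1, ENNReal.ofReal_one])).toMeasure,
    inferInstance⟩

theorem finiteProb_real {Z : Type} [Fintype Z] [MeasurableSpace Z] [MeasurableSingletonClass Z]
    (f : Z → ℝ) (hf : ∀ z, 0 ≤ f z) (hf1 : ∑ z, f z = 1) (z : Z) :
    (finiteProb f hf hf1 : Measure Z).real {z} = f z := by
  simp only [finiteProb, ProbabilityMeasure.coe_mk, Measure.real]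
  rw [PMF.toMeasure_apply_singleton _ _ (measurableSet_singleton z), PMF.ofFintype_apply,
    ENNReal.toReal_ofReal (hf z)]

theorem risk_cubeModel (f : Option (Fin d × Bool) → ℝ) (hf : ∀ z, 0 ≤ f z) (hf1 : ∑ z, f z = 1)
    (θ : Fin d → ℝ) : (cubeModel d).risk (finiteProb f hf hf1) θ =
      ∑ j, (f (some (j, true)) * (1 / 2 + θ j) + f (some (j, false)) * (1 / 2 - θ j)) := by
  unfold Model.risk
  rw [integral_fintype Integrable.of_finite]
  simp only [finiteProb_real, smul_eq_mul]
  rw [Fintype.sum_option, Fintype.sum_prod_type]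
  simp [cubeModel, cubeLoss, sub_eq_add_neg]

theorem opt_le {E Z : Type} [NormedAddCommGroup E] [NormedSpace ℝ E] [MeasurableSpace Z]
    (M : Model E Z) {n : ℕ} (P : Fin n → ProbabilityMeasure Z) {θ : E} (hθ : θ ∈ M.Θ) :
    M.opt P ≤ M.worstRisk P θ := by
  refine csInf_le ⟨0, ?_⟩ ⟨θ, hθ, rfl⟩
  rintro _ ⟨θ', hθ', rfl⟩
  exact Real.iSup_nonneg fun i => integral_nonneg fun z => (M.loss_mem θ' hθ' z).1

theorem risk_le_worstRisk {E Z : Type} [NormedAddCommGroup E] [NormedSpace ℝ E]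
    [MeasurableSpace Z] (M : Model E Z) {n : ℕ} (P : Fin n → ProbabilityMeasure Z) (θ : E)
    (i : Fin n) : M.risk (P i) θ ≤ M.worstRisk P θ :=
  le_ciSup (f := fun i => M.risk (P i) θ) (Set.finite_range _).bddAbove i

end Cube

/-! ### Biased coordinates: the problems behind the term D -/

section Dimension

variable {d n : ℕ}

/-- The masses of the datapoints when the coordinate is uniform and, given that the coordinate is
`j`, the sign has mean `b` or `-b` depending on `v j`. -/
def biasedMass (b : ℝ) (v : Fin d → Bool) : Option (Fin d × Bool) → ℝ
  | none => 0
  | some (j, s) => (1 + sgn s * sgn (v j) * b) / (2 * d)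

theorem abs_sgn_mul_sgn_mul (s t : Bool) (b : ℝ) : |sgn s * sgn t * b| = |b| := by
  rw [abs_mul, abs_mul, abs_sgn, abs_sgn, one_mul, one_mul]

theorem biasedMass_nonneg {b : ℝ} (hb : |b| ≤ 1) (v : Fin d → Bool) (z : Option (Fin d × Bool)) :
    0 ≤ biasedMass b v z := by
  rcases z with _ | ⟨j, s⟩
  · exact le_rfl
  · have := (abs_le.1 ((abs_sgn_mul_sgn_mul s (v j) b).le.trans hb)).1
    exact div_nonneg (by linarith) (by positivity)

theorem sum_biasedMass (hd : 0 < d) (b : ℝ) (v : Fin d → Bool) : ∑ z, biasedMass b v z = 1 := by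
  have : (d : ℝ) ≠ 0 := by positivity
  rw [Fintype.sum_option, Fintype.sum_prod_type]
  simp only [biasedMass, Fintype.sum_bool, sgn_true, sgn_false]
  have h : ∀ j, (1 + 1 * sgn (v j) * b) / (2 * d) + (1 + -1 * sgn (v j) * b) / (2 * d)
      = 1 / (d : ℝ) := fun j => by field_simp; ring
  simp only [h]
  simp [this]

/-- The data distribution with the masses `biasedMass b v`. -/
def biasedProb (hd : 0 < d) {b : ℝ} (hb : |b| ≤ 1) (v : Fin d → Bool) :
    ProbabilityMeasure (Option (Fin d × Bool)) :=
  finiteProb (biasedMass b v) (biasedMass_nonneg hb v) (sum_biasedMass hd b v)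

/-- The form isolates the excess risk: on the cube every summand is nonnegative, and all vanish when
θ opposes the biases. So below, a sign of θ that agrees with `v` is an error. -/
theorem risk_biasedProb (hd : 0 < d) {b : ℝ} (hb : |b| ≤ 1) (v : Fin d → Bool) (θ : Fin d → ℝ) :
    (cubeModel d).risk (biasedProb hd hb v) θ = 1 / 2 - b / 2 +
      b / d * ∑ j, (sgn (v j) * θ j + 1 / 2) := by
  have : (d : ℝ) ≠ 0 := by positivity
  rw [biasedProb, risk_cubeModel]
  have h : ∀ j, biasedMass b v (some (j, true)) * (1 / 2 + θ j) +
      biasedMass b v (some (j, false)) * (1 / 2 - θ j)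
      = 1 / d * (1 / 2 - b / 2) + b / d * (sgn (v j) * θ j + 1 / 2) := by
    intro j
    simp only [biasedMass, sgn_true, sgn_false]
    field_simp
    ring
  simp only [h]
  rw [Finset.sum_add_distrib, Finset.mul_sum]
  congr 1
  simp
  field_simp

/-- An almost optimal parameter for the biases `v` has the correct sign in most coordinates. -/
theorem card_wrong_le (hd : 0 < d) (hn : 0 < n) {b ε : ℝ} (hb0 : 0 < b) (hb : |b| ≤ 1)
    (v : Fin d → Bool) {θ : Fin d → ℝ}
    (hθ : (cubeModel d).IsEpsOptimal (fun _ : Fin n => biasedProb hd hb v) ε θ) :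
    ∑ j, (if decide (0 ≤ θ j) = v j then (1 : ℝ) else 0) ≤ 2 * ε / b * d := by
  have : Nonempty (Fin n) := ⟨⟨0, hn⟩⟩
  have hd' : (0 : ℝ) < d := by positivity
  have hw : ∀ θ, (cubeModel d).worstRisk (fun _ : Fin n => biasedProb hd hb v) θ
      = (cubeModel d).risk (biasedProb hd hb v) θ := fun θ => ciSup_const
  obtain ⟨hθ1, hθ2⟩ := hθ
  have hopt := opt_le (cubeModel d) (fun _ : Fin n => biasedProb hd hb v) (mul_sgn_mem_cube v)
  rw [hw, risk_biasedProb] at hopt hθ2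
  have h0 : ∀ j, sgn (v j) * -(sgn (v j) / 2) + 1 / 2 = 0 := fun j => by
    cases v j <;> norm_num
  simp only [h0, Finset.sum_const_zero, mul_zero, add_zero] at hopt
  have h1 : b / d * ∑ j, (sgn (v j) * θ j + 1 / 2) ≤ ε := by linarith
  have h2 : ∑ j, (if decide (0 ≤ θ j) = v j then (1 / 2 : ℝ) else 0)
      ≤ ∑ j, (sgn (v j) * θ j + 1 / 2) := by
    refine Finset.sum_le_sum fun j _ => ?_
    split_ifs with h
    · by_cases hj : 0 ≤ θ j
      · rw [← h]; simp [hj]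
      · rw [← h]; simp [hj]; linarith
    · exact sgn_mul_add_half_nonneg hθ1 _ _
  have h3 : ∑ j, (if decide (0 ≤ θ j) = v j then (1 : ℝ) else 0)
      = 2 * ∑ j, (if decide (0 ≤ θ j) = v j then (1 / 2 : ℝ) else 0) := by
    rw [Finset.mul_sum]
    refine Finset.sum_congr rfl fun j _ => ?_
    split_ifs <;> norm_num
  rw [h3]
  have h4 : ∑ j, (sgn (v j) * θ j + 1 / 2) ≤ ε / b * d := by
    rw [div_mul_eq_mul_div, le_div_iff₀ hb0]
    rw [div_mul_eq_mul_div, div_le_iff₀ hd'] at h1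
    linarith
  calc _ ≤ 2 * (ε / b * d) := by linarith
    _ = _ := by ring

/-- The likelihood ratio of a datapoint when the bias of coordinate `j` is flipped. -/
def flipRatio (b : ℝ) (v : Fin d → Bool) (j : Fin d) : Option (Fin d × Bool) → ℝ
  | none => 1
  | some (k, s) => if k = j then (1 - sgn s * sgn (v j) * b) / (1 + sgn s * sgn (v j) * b) else 1

/-- The biases `v` with the bias of coordinate `j` flipped. -/
def flipAt (j : Fin d) (v : Fin d → Bool) : Fin d → Bool := Function.update v j (!v j)

theorem flipAt_involutive (j : Fin d) : Function.Involutive (flipAt j) := by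
  intro v
  simp [flipAt]

theorem sum_flipAt (j : Fin d) (g : (Fin d → Bool) → ℝ) :
    ∑ v, g (flipAt j v) = ∑ v, g v :=
  Equiv.sum_comp (flipAt_involutive j).toPerm g

theorem one_add_sgn_pos {b : ℝ} (hb : |b| < 1) (s t : Bool) : 0 < 1 + sgn s * sgn t * b := by
  have := (abs_lt.1 ((abs_sgn_mul_sgn_mul s t b).le.trans_lt hb)).1
  linarith

theorem biasedMass_flipAt {b : ℝ} (hb : |b| < 1) (v : Fin d → Bool) (j : Fin d)
    (z : Option (Fin d × Bool)) :
    biasedMass b (flipAt j v) z = biasedMass b v z * flipRatio b v j z := by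
  rcases z with _ | ⟨k, s⟩
  · simp [biasedMass]
  · have := (one_add_sgn_pos hb s (v k)).ne'
    by_cases hk : k = j
    · subst hk
      have e : sgn (!v k) = -sgn (v k) := by cases v k <;> simp
      simp only [biasedMass, flipAt, flipRatio, Function.update_self, if_true, e]
      field_simp
      ring
    · simp [biasedMass, flipAt, flipRatio, hk]

-- Here κ is the second moment, under a sign of mean b, of the likelihood ratio to mean -b: half of
-- (1-b)²/(1+b) + (1+b)²/(1-b). The discount on coordinate `j` makes the tilted masses a probability
-- again.
open Classical in
theorem sum_biasedMass_mul_flipRatio (hd : 0 < d) {b : ℝ} (hb : |b| < 1) (v : Fin d → Bool)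
    (j : Fin d) {κ : ℝ} (hκ : κ = (1 + 3 * b ^ 2) / (1 - b ^ 2)) :
    ∑ z, biasedMass b v z * flipRatio b v j z ^ 2 * (if ∃ s, z = some (j, s) then κ⁻¹ else 1)
      = 1 := by
  have hd' : (d : ℝ) ≠ 0 := by positivity
  have hb2 : 0 < 1 - b ^ 2 := by
    have := (sq_lt_one_iff_abs_lt_one b).2 hb
    linarith
  rw [Fintype.sum_option, Fintype.sum_prod_type]
  have h : ∀ k, ∑ s, biasedMass b v (some (k, s)) * flipRatio b v j (some (k, s)) ^ 2 *
      (if ∃ s', some (k, s) = some (j, s') then κ⁻¹ else 1) = 1 / (d : ℝ) := by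
    intro k
    by_cases hk : k = j
    · subst hk
      have h1 : ∀ s : Bool, ∃ s' : Bool, some (k, s) = some (k, s') := fun s => ⟨s, rfl⟩
      simp only [h1, if_true, biasedMass, flipRatio, Fintype.sum_bool, sgn_true, sgn_false]
      have hp := (one_add_sgn_pos hb true (v k)).ne'
      have hm := (one_add_sgn_pos hb false (v k)).ne'
      have hs : sgn (v k) = 1 ∨ sgn (v k) = -1 := by cases v k <;> simp
      have h3 : 1 + 3 * b ^ 2 ≠ 0 := by positivity
      simp only [sgn_true, sgn_false] at hp hm
      rw [hκ]
      have hb2' := hb2.ne'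
      have e1 : 1 - b ^ 2 = (1 + b) * (1 - b) := by ring
      rw [e1] at hb2' ⊢
      have ha := left_ne_zero_of_mul hb2'
      have hc := right_ne_zero_of_mul hb2'
      have hc' : 1 + -b ≠ 0 := by simpa [sub_eq_add_neg] using hc
      rcases hs with hs | hs <;> rw [hs] <;> norm_num <;>
        simp only [← sub_eq_add_neg] <;> field_simp <;> ring
    · have h1 : ∀ s : Bool, ¬ ∃ s' : Bool, some (k, s) = some (j, s') := fun s ⟨s', h⟩ => hk (by
        simp at h; exact h.1)
      simp only [h1, if_false, flipRatio, hk, biasedMass, Fintype.sum_bool, sgn_true, sgn_false]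
      field_simp
      ring
  simp only [h]
  simp [biasedMass, hd']

end Dimension

/-! ### Assouad's argument over the coordinates -/

section Dimension

variable {d n : ℕ}

/-- The datapoint belongs to coordinate `j`. -/
def OnCoord (j : Fin d) (_ : Fin n) (z : Option (Fin d × Bool)) : Prop := ∃ s, z = some (j, s)

theorem sum_tally_onCoord_le (q : ∀ t, (Fin t → Option (Fin d × Bool)) → Fin n)
    (h : Hist (Option (Fin d × Bool))) : ∑ j, (tally q (OnCoord j) h : ℝ) ≤ h.1 := by
  have := sum_tally_le (q := q) Finset.univ (fun j : Fin d => OnCoord (n := n) j)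
    (fun i z a _ b _ ⟨s, hs⟩ ⟨s', hs'⟩ => by
      rw [hs] at hs'
      simp at hs'
      exact hs'.1) h
  exact_mod_cast this

open Classical in
/-- A second moment bound for the likelihood ratio of flipping the bias of coordinate `j`,
restricted to few datapoints of that coordinate. -/
theorem sum_weight_flipRatio_sq_le (hd : 0 < d) {b : ℝ} (hb : |b| < 1) (v : Fin d → Bool)
    (j : Fin d) {κ : ℝ} (hκ : κ = (1 + 3 * b ^ 2) / (1 - b ^ 2))
    (q : ∀ t, (Fin t → Option (Fin d × Bool)) → Fin n)
    (halt : ∀ t, Set (Fin t → Option (Fin d × Bool))) (T : ℕ) {B : ℝ} :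
    ∑ h ∈ (terminal halt T).filter fun h => (tally q (OnCoord j) h : ℝ) ≤ B,
      weight q (fun _ => biasedMass b v) h * weight q (fun _ => flipRatio b v j) h ^ 2 ≤ κ ^ B := by
  have hb2 : 0 < 1 - b ^ 2 := by
    have := (sq_lt_one_iff_abs_lt_one b).2 hb
    linarith
  have hκ1 : 1 ≤ κ := by
    rw [hκ, le_div_iff₀ hb2]
    nlinarith [sq_nonneg b]
  -- Discounted tilted masses: Kraft's inequality bounds their total over all histories, and
  -- removing the discount costs at most κ^B when the tally is at most `B`.
  let R : Fin n → Option (Fin d × Bool) → ℝ := fun i z => biasedMass b v z * flipRatio b v j z ^ 2 *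
    (if OnCoord j i z then κ⁻¹ else 1)
  have hR0 : ∀ i z, 0 ≤ R i z := fun i z => by
    refine mul_nonneg (mul_nonneg (biasedMass_nonneg hb.le v z) (sq_nonneg _)) ?_
    split_ifs <;> positivity
  have hR1 : ∀ i, ∑ z, R i z ≤ 1 := fun i => by
    refine Eq.le ?_
    convert sum_biasedMass_mul_flipRatio hd hb v j hκ
    exact Iff.rfl
  have hwR : ∀ h, weight q R h = weight q (fun _ => biasedMass b v) h *
      weight q (fun _ => flipRatio b v j) h ^ 2 * κ⁻¹ ^ tally q (OnCoord j) h := by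
    intro h
    simp only [R, sq]
    rw [weight_mul, weight_ite, weight_mul, weight_mul]
  calc _ ≤ ∑ h ∈ (terminal halt T).filter fun h => (tally q (OnCoord j) h : ℝ) ≤ B,
        weight q R h * κ ^ B := by
        refine Finset.sum_le_sum fun h hh => ?_
        have h1 := (Finset.mem_filter.1 hh).2
        rw [hwR, mul_assoc]
        refine le_mul_of_one_le_right (mul_nonneg (weight_nonneg (fun _ z =>
          biasedMass_nonneg hb.le v z) _) (sq_nonneg _)) ?_
        rw [inv_pow, ← Real.rpow_natCast, ← Real.rpow_neg (by linarith),
          ← Real.rpow_add (by linarith)]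
        exact Real.one_le_rpow hκ1 (by linarith)
    _ ≤ ∑ h ∈ terminal halt T, weight q R h * κ ^ B :=
        Finset.sum_le_sum_of_subset_of_nonneg (Finset.filter_subset _ _) fun h _ _ =>
          mul_nonneg (weight_nonneg hR0 h) (by positivity)
    _ ≤ 1 * κ ^ B := by
        rw [← Finset.sum_mul]
        gcongr
        exact sum_weight_terminal_le_one hR0 hR1 halt T
    _ = _ := one_mul _

theorem weight_flipAt {b : ℝ} (hb : |b| < 1) (v : Fin d → Bool) (j : Fin d)
    (q : ∀ t, (Fin t → Option (Fin d × Bool)) → Fin n) (h : Hist (Option (Fin d × Bool))) :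
    weight q (fun _ => biasedMass b (flipAt j v)) h =
      weight q (fun _ => biasedMass b v) h * weight q (fun _ => flipRatio b v j) h := by
  rw [← weight_mul]
  congr 1
  funext i z
  exact biasedMass_flipAt hb v j z

open Classical in
/-- For one coordinate: the probabilities of the two answers are close when there are few
datapoints of that coordinate. -/
theorem sum_weight_sub_two_mul_wrong_le (hd : 0 < d) {b : ℝ} (hb : |b| < 1) (j : Fin d) {κ : ℝ}
    (hκ : κ = (1 + 3 * b ^ 2) / (1 - b ^ 2)) {π : ℝ} (hπ : 0 ≤ π)
    (hπ1 : ∑ _v : Fin d → Bool, π = 1)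
    (q : ∀ t, (Fin t → Option (Fin d × Bool)) → Fin n)
    (halt : ∀ t, Set (Fin t → Option (Fin d × Bool))) (T : ℕ) {B : ℝ}
    (answer : Hist (Option (Fin d × Bool)) → Bool) {t : ℝ} (ht : 0 < t)
    {H : Finset (Hist (Option (Fin d × Bool)))}
    (hH : H = (terminal halt T).filter fun h => (tally q (OnCoord j) h : ℝ) ≤ B) :
    (∑ v, π * ∑ h ∈ H, weight q (fun _ => biasedMass b v) h)
      - 2 * ∑ v : Fin d → Bool, π * ∑ h ∈ H, (if answer h = v j then 1 else 0) *
          weight q (fun _ => biasedMass b v) h ≤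
    t / 2 + 1 / (2 * t) * (κ ^ B - ∑ v, π * ∑ h ∈ H, weight q (fun _ => biasedMass b v) h) := by
  set w : (Fin d → Bool) → Hist (Option (Fin d × Bool)) → ℝ :=
    fun v h => weight q (fun _ => biasedMass b v) h with hw
  set r : (Fin d → Bool) → Hist (Option (Fin d × Bool)) → ℝ :=
    fun v h => weight q (fun _ => flipRatio b v j) h with hr
  have hflip : ∀ v h, w (flipAt j v) h = w v h * r v h := fun v h => weight_flipAt hb v j q h
  have hw0 : ∀ v h, 0 ≤ w v h := fun v h => weight_nonneg (fun _ z => biasedMass_nonneg hb.le v z) h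
  -- Reindexing by the flip preserves the constant prior, and `H` does not depend on `v`. Errors
  -- under `v` become correct answers weighted by the likelihood ratio.
  have e1 : ∑ v : Fin d → Bool, π * ∑ h ∈ H, (if answer h = v j then 1 else 0) * w v h
      = ∑ v : Fin d → Bool, π * ∑ h ∈ H, (if answer h = v j then 0 else 1) * (w v h * r v h) := by
    rw [← sum_flipAt j fun v => π * ∑ h ∈ H, (if answer h = v j then 1 else 0) * w v h]
    refine Finset.sum_congr rfl fun v _ => ?_
    congr 1
    refine Finset.sum_congr rfl fun h _ => ?_
    rw [hflip]
    congr 1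
    simp only [flipAt, Function.update_self]
    cases answer h <;> cases v j <;> simp
  have e2 : ∑ v, π * ∑ h ∈ H, w v h = ∑ v, π * ∑ h ∈ H, w v h * r v h := by
    rw [← sum_flipAt j fun v => π * ∑ h ∈ H, w v h]
    simp only [hflip]
  have e3 : ∀ v, ∑ h ∈ H, w v h ≤ 1 := fun v =>
    (Finset.sum_le_sum_of_subset_of_nonneg (hH ▸ Finset.filter_subset _ _) fun h _ _ =>
      hw0 v h).trans (sum_weight_terminal_le_one (fun _ z => biasedMass_nonneg hb.le v z)
        (fun _ => (sum_biasedMass hd b v).le) halt T)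
  have e4 : ∀ v, ∑ h ∈ H, w v h * r v h ^ 2 ≤ κ ^ B := fun v => by
    rw [hH]
    exact sum_weight_flipRatio_sq_le hd hb v j hκ q halt T
  -- The left side is 0 or w(1 - r). The inequality 1 - r ≤ t/2 + (1 - r)²/(2t) stands in for
  -- Cauchy–Schwarz and leaves only second moments.
  have key : ∀ v : Fin d → Bool, ∀ h, w v h - (if answer h = v j then 1 else 0) * w v h
      - (if answer h = v j then 0 else 1) * (w v h * r v h)
      ≤ t / 2 * w v h + 1 / (2 * t) * (w v h * r v h ^ 2 - 2 * (w v h * r v h) + w v h) := by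
    intro v h
    have h1 : 1 - r v h ≤ t / 2 + 1 / (2 * t) * (1 - r v h) ^ 2 := by
      have : t / 2 + 1 / (2 * t) * (1 - r v h) ^ 2 - (1 - r v h)
          = 1 / (2 * t) * (t - (1 - r v h)) ^ 2 := by field_simp; ring
      have h2 : 0 ≤ 1 / (2 * t) * (t - (1 - r v h)) ^ 2 := by positivity
      linarith
    have h0 : 0 ≤ t / 2 + 1 / (2 * t) * (1 - r v h) ^ 2 := by positivity
    have h3 : t / 2 * w v h + 1 / (2 * t) * (w v h * r v h ^ 2 - 2 * (w v h * r v h) + w v h)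
        = w v h * (t / 2 + 1 / (2 * t) * (1 - r v h) ^ 2) := by ring
    rw [h3]
    split_ifs
    · have := mul_nonneg (hw0 v h) h0
      linarith
    · have := mul_le_mul_of_nonneg_left h1 (hw0 v h)
      linarith
  have key2 : ∑ v : Fin d → Bool, π * ∑ h ∈ H, (w v h - (if answer h = v j then 1 else 0) * w v h
      - (if answer h = v j then 0 else 1) * (w v h * r v h))
      ≤ ∑ v : Fin d → Bool, π * ∑ h ∈ H, (t / 2 * w v h +
        1 / (2 * t) * (w v h * r v h ^ 2 - 2 * (w v h * r v h) + w v h)) := by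
    gcongr
    exact key _ _
  simp only [Finset.sum_sub_distrib, Finset.sum_add_distrib, ← Finset.mul_sum, mul_sub,
    mul_add] at key2
  have e5 : ∑ v : Fin d → Bool, π * (t / 2 * ∑ h ∈ H, w v h) ≤ t / 2 := by
    calc _ ≤ ∑ v : Fin d → Bool, π * (t / 2 * 1) := by
          gcongr; exact e3 _
      _ = t / 2 := by rw [← Finset.sum_mul, hπ1]; ring
  have e6 : ∑ v : Fin d → Bool, π * ∑ h ∈ H, w v h * r v h ^ 2 ≤ κ ^ B := by
    calc _ ≤ ∑ v : Fin d → Bool, π * κ ^ B := by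
          gcongr; exact e4 _
      _ = κ ^ B := by rw [← Finset.sum_mul, hπ1]; ring
  have h2t : 0 < 1 / (2 * t) := by positivity
  have e7 := mul_le_mul_of_nonneg_left e6 h2t.le
  have e8 := congrArg (fun x => 1 / (2 * t) * x) e2
  simp only [← Finset.mul_sum] at e1 e5 e7 e8 ⊢
  linarith

open Classical in
/-- Assouad's argument: a deterministic algorithm which finds most signs on average over the biases
needs many datapoints. -/
theorem le_of_mostly_correct (hd : 0 < d) {ε : ℝ} (hε : 0 < ε) (hε1 : ε < 1 / 8) {π δ S : ℝ}
    (hπ : 0 ≤ π) (hπ1 : ∑ _v : Fin d → Bool, π = 1) (hδ : δ ≤ 101 / 800)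
    (q : ∀ t, (Fin t → Option (Fin d × Bool)) → Fin n)
    (halt : ∀ t, Set (Fin t → Option (Fin d × Bool))) (T : ℕ)
    (out : Hist (Option (Fin d × Bool)) → Fin d → ℝ) (good : (Fin d → Bool) → Set (Fin d → ℝ))
    (hgood : ∀ v, ∀ θ ∈ good v,
      ∑ j, (if decide (0 ≤ θ j) = v j then (1 : ℝ) else 0) ≤ 2 / 7 * d)
    (h1 : ∀ v, 1 - 1 / 2000 ≤ ∑ h ∈ terminal halt T, weight q (fun _ => biasedMass (7 * ε) v) h)
    (h2 : ∑ v, π * ∑ h ∈ terminal halt T, weight q (fun _ => biasedMass (7 * ε) v) h * h.1 ≤ S)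
    (h3 : ∑ v, π * ∑ h ∈ (terminal halt T).filter fun h => out h ∉ good v,
      weight q (fun _ => biasedMass (7 * ε) v) h ≤ δ) :
    (d : ℝ) / (4 * 10 ^ 8 * ε ^ 2) < S := by
  have hd' : (0 : ℝ) < d := by positivity
  by_contra! hS
  set b : ℝ := 7 * ε with hbdef
  have hb : |b| < 1 := by rw [abs_of_pos (by positivity)]; linarith
  -- With κ ≤ 1 + 1000ε² this makes κ^B ≤ exp(1/200): so few samples of a coordinate carry almost no
  -- information.
  set B : ℝ := 1 / (200000 * ε ^ 2) with hB
  have hBpos : 0 < B := by positivity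
  set κ : ℝ := (1 + 3 * b ^ 2) / (1 - b ^ 2) with hκ
  have hK : κ ^ B ≤ 101 / 100 := by
    have hb2 : 15 / 64 ≤ 1 - b ^ 2 := by nlinarith
    have hκ1 : κ ≤ 1 + 1000 * ε ^ 2 := by
      rw [hκ, div_le_iff₀ (by linarith)]
      have : b ^ 2 = 49 * ε ^ 2 := by rw [hbdef]; ring
      nlinarith [sq_nonneg ε]
    have hκ0 : 0 ≤ κ := by rw [hκ]; apply div_nonneg <;> nlinarith [sq_nonneg b]
    calc κ ^ B ≤ (Real.exp (1000 * ε ^ 2)) ^ B := by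
          apply Real.rpow_le_rpow hκ0 _ hBpos.le
          linarith [Real.add_one_le_exp (1000 * ε ^ 2)]
      _ = Real.exp (1 / 200) := by
          rw [← Real.exp_mul]
          congr 1
          rw [hB]; field_simp; norm_num
      _ ≤ 101 / 100 := by
          have := Real.exp_bound_div_one_sub_of_interval (x := 1 / 200) (by norm_num) (by norm_num)
          refine this.trans ?_
          norm_num
  set w : (Fin d → Bool) → Hist (Option (Fin d × Bool)) → ℝ :=
    fun v h => weight q (fun _ => biasedMass b v) h with hw
  have hw0 : ∀ v h, 0 ≤ w v h := fun v h => weight_nonneg (fun _ z => biasedMass_nonneg hb.le v z) h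
  have hw1 : ∀ v, ∑ h ∈ terminal halt T, w v h ≤ 1 := fun v =>
    sum_weight_terminal_le_one (fun _ z => biasedMass_nonneg hb.le v z)
        (fun _ => (sum_biasedMass hd b v).le) halt T
  let H : Fin d → Finset (Hist (Option (Fin d × Bool))) := fun j =>
    (terminal halt T).filter fun h => (tally q (OnCoord j) h : ℝ) ≤ B
  let W : Fin d → ℝ := fun j => ∑ v, π * ∑ h ∈ H j, w v h
  let X : Fin d → ℝ := fun j => ∑ v : Fin d → Bool, π * ∑ h ∈ H j,
    (if decide (0 ≤ out h j) = v j then 1 else 0) * w v h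
  have hWX : ∀ j, W j - 2 * X j ≤ (1 / 10 : ℝ) / 2 + 1 / (2 * (1 / 10)) * (κ ^ B - W j) := fun j =>
    sum_weight_sub_two_mul_wrong_le hd hb j hκ hπ hπ1 q halt T (fun h => decide (0 ≤ out h j))
      (by norm_num) rfl
  have hWlow : (d : ℝ) * (1 - 1 / 2000) - S / B ≤ ∑ j, W j := by
    -- Markov's inequality for each coordinate, in the form that the indicator of tally ≤ B is at
    -- least 1 - tally/B. Summed over `j`, the tallies add up to at most the length.
    have a1 : ∀ v j, ∑ h ∈ terminal halt T, w v h * (1 - tally q (OnCoord j) h / B)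
        ≤ ∑ h ∈ H j, w v h := by
      intro v j
      rw [Finset.sum_filter]
      refine Finset.sum_le_sum fun h _ => ?_
      split_ifs with hc
      · refine mul_le_of_le_one_right (hw0 v h) ?_
        have : 0 ≤ (tally q (OnCoord j) h : ℝ) / B := by positivity
        linarith
      · refine mul_nonpos_of_nonneg_of_nonpos (hw0 v h) ?_
        rw [sub_nonpos, le_div_iff₀ hBpos]
        linarith
    have a2 : ∀ v, (d : ℝ) * (1 - 1 / 2000) - (∑ h ∈ terminal halt T, w v h * h.1) / B
        ≤ ∑ j, ∑ h ∈ H j, w v h := by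
      intro v
      refine le_trans ?_ (Finset.sum_le_sum fun j _ => a1 v j)
      rw [Finset.sum_comm]
      have a3 : ∀ h, ∑ j, w v h * (1 - (tally q (OnCoord j) h : ℝ) / B)
          = d * w v h - w v h * (∑ j, (tally q (OnCoord j) h : ℝ)) / B := by
        intro h
        rw [← Finset.mul_sum, Finset.sum_sub_distrib, ← Finset.sum_div]
        simp
        ring
      simp only [a3]
      rw [Finset.sum_sub_distrib, ← Finset.mul_sum, Finset.sum_div]
      apply sub_le_sub
      · exact mul_le_mul_of_nonneg_left (h1 v) hd'.le
      · refine Finset.sum_le_sum fun h _ => ?_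
        have := mul_le_mul_of_nonneg_left (sum_tally_onCoord_le q h) (hw0 v h)
        gcongr
    have a4 : ∑ j, W j = ∑ v, π * ∑ j, ∑ h ∈ H j, w v h := by
      simp only [W]
      rw [Finset.sum_comm]
      simp only [Finset.mul_sum]
    rw [a4]
    calc _ ≤ (∑ v : Fin d → Bool, π * ((d : ℝ) * (1 - 1 / 2000)))
          - (∑ v, π * ∑ h ∈ terminal halt T, w v h * h.1) / B := by
          rw [← Finset.sum_mul, hπ1, one_mul]
          gcongr
      _ = ∑ v, π * ((d : ℝ) * (1 - 1 / 2000) - (∑ h ∈ terminal halt T, w v h * h.1) / B) := by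
          rw [Finset.sum_div, ← Finset.sum_sub_distrib]
          exact Finset.sum_congr rfl fun v _ => by ring
      _ ≤ _ := by
          gcongr
          exact a2 _
  have hX : ∑ j, X j ≤ d * δ + 2 / 7 * d := by
    have a1 : ∀ v : Fin d → Bool, ∑ j, ∑ h ∈ H j,
        (if decide (0 ≤ out h j) = v j then 1 else 0) * w v h
        ≤ d * (∑ h ∈ (terminal halt T).filter fun h => out h ∉ good v, w v h) + 2 / 7 * d := by
      intro v
      calc _ ≤ ∑ j, ∑ h ∈ terminal halt T,
            (if decide (0 ≤ out h j) = v j then 1 else 0) * w v h :=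
            Finset.sum_le_sum fun j _ => Finset.sum_le_sum_of_subset_of_nonneg
              (Finset.filter_subset _ _) fun h _ _ =>
                mul_nonneg (by split_ifs <;> norm_num) (hw0 v h)
        _ = ∑ h ∈ terminal halt T,
            (∑ j, if decide (0 ≤ out h j) = v j then 1 else 0) * w v h := by
            rw [Finset.sum_comm]
            simp only [Finset.sum_mul]
        _ ≤ ∑ h ∈ terminal halt T, (d * (if out h ∉ good v then w v h else 0)
              + 2 / 7 * d * w v h) := by
            refine Finset.sum_le_sum fun h _ => ?_
            have b0 := mul_nonneg hd'.le (hw0 v h)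
            by_cases hg : out h ∈ good v
            · have := mul_le_mul_of_nonneg_right (hgood v _ hg) (hw0 v h)
              simpa [hg] using this
            · have b1 : (∑ j, if decide (0 ≤ out h j) = v j then (1 : ℝ) else 0) ≤ d := by
                refine (Finset.sum_le_sum (g := fun _ => (1 : ℝ)) fun j _ => ?_).trans (by simp)
                split_ifs <;> norm_num
              have := mul_le_mul_of_nonneg_right b1 (hw0 v h)
              simp only [hg, not_false_iff, if_true]
              linarith
        _ ≤ _ := by
            rw [Finset.sum_add_distrib, ← Finset.mul_sum, ← Finset.mul_sum, ← Finset.sum_filter]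
            have := mul_le_mul_of_nonneg_left (hw1 v) (by positivity : (0 : ℝ) ≤ 2 / 7 * d)
            linarith
    have a4 : ∑ j, X j = ∑ v : Fin d → Bool, π * ∑ j, ∑ h ∈ H j,
        (if decide (0 ≤ out h j) = v j then 1 else 0) * w v h := by
      simp only [X]
      rw [Finset.sum_comm]
      exact Finset.sum_congr rfl fun v _ => (Finset.mul_sum _ _ _).symm
    rw [a4]
    calc _ ≤ ∑ v : Fin d → Bool, π *
          (d * (∑ h ∈ (terminal halt T).filter fun h => out h ∉ good v, w v h) + 2 / 7 * d) := by
          gcongr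
          exact a1 _
      _ = d * (∑ v, π * (∑ h ∈ (terminal halt T).filter fun h => out h ∉ good v, w v h))
          + (∑ _v : Fin d → Bool, π) * (2 / 7 * d) := by
          rw [Finset.mul_sum, Finset.sum_mul, ← Finset.sum_add_distrib]
          exact Finset.sum_congr rfl fun v _ => by ring
      _ ≤ _ := by
          rw [hπ1, one_mul]
          gcongr
  have hsum : ∑ j, (W j - 2 * X j) ≤
      ∑ _j : Fin d, ((1 / 10 : ℝ) / 2 + 1 / (2 * (1 / 10)) * κ ^ B)
        - 1 / (2 * (1 / 10)) * ∑ j, W j := by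
    rw [Finset.mul_sum, ← Finset.sum_sub_distrib]
    exact Finset.sum_le_sum fun j _ => (hWX j).trans (by linarith)
  rw [Finset.sum_sub_distrib, ← Finset.mul_sum, Finset.sum_const, Finset.card_univ,
    Fintype.card_fin, nsmul_eq_mul] at hsum
  have hSB : S / B ≤ d * (1 / 2000) := by
    rw [div_le_iff₀ hBpos]
    refine hS.trans (le_of_eq ?_)
    rw [hB]; field_simp; norm_num
  have hdδ : d * δ ≤ d * (101 / 800) := by gcongr
  have hdK : d * κ ^ B ≤ d * (101 / 100) := by gcongr
  -- Per coordinate, the left side is at least 0.999 - 2(2/7 + 101/800) > 0.17, while the right side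
  -- is at most 0.05 + 5(1.01 - 0.999) = 0.105.
  nlinarith

open Classical in
/-- The lower bound of order `d / ε ^ 2`. -/
theorem exists_expectedSamples_ge_dimension (hd : 0 < d) (hn : 0 < n) {ε δ : ℝ} (hε : 0 < ε)
    (hε1 : ε < 1 / 8) (hδ : 0 < δ) (hδ1 : δ < 1 / 8) (hb : |7 * ε| ≤ 1)
    (A : Algorithm n (Fin d → ℝ) (Option (Fin d × Bool)))
    (hA : ∀ v, A.Solves (cubeModel d) (fun _ => biasedProb hd hb v) ε δ) :
    ∃ v, ENNReal.ofReal (d / (101 * (4 * 10 ^ 8 * ε ^ 2))) ≤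
      A.expectedSamples fun _ => biasedProb hd hb v := by
  by_contra! hlt
  have hd' : (0 : ℝ) < d := by positivity
  let π : ℝ := ((Fintype.card (Fin d → Bool) : ℝ))⁻¹
  have hπ : 0 < π := by
    have : 0 < Fintype.card (Fin d → Bool) := Fintype.card_pos
    positivity
  have hπ1 : ∑ _v : Fin d → Bool, π = 1 := by
    rw [Finset.sum_const, Finset.card_univ, nsmul_eq_mul]
    exact mul_inv_cancel₀ (by positivity)
  -- The fraction 2/7 is 2ε/b at b = 7ε. This bias remains below 1 for ε < 1/8, and 2/7 plus the
  -- failure probability stays below the 1/2 of a blind guess.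
  let good : (Fin d → Bool) → Set (Fin d → ℝ) := fun v =>
    {θ | ∑ j, (if decide (0 ≤ θ j) = v j then (1 : ℝ) else 0) ≤ 2 / 7 * d}
  have hgm : ∀ v, MeasurableSet (good v) := by
    intro v
    refine measurableSet_le (Finset.measurable_sum _ fun j _ => ?_) measurable_const
    refine Measurable.ite ?_ measurable_const measurable_const
    have h1 : MeasurableSet {θ : Fin d → ℝ | 0 ≤ θ j} :=
      measurableSet_le measurable_const (measurable_pi_apply j)
    cases hv : v j
    · simpa [Set.compl_ofPred] using h1.compl
    · simpa using h1
  obtain ⟨q, halt, out, hdet⟩ := A.exists_deterministic (fun v _ => biasedProb hd hb v)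
    (fun _ => π) (fun _ => hπ) hπ1 good hgm hδ (by linarith)
    (B := d / (101 * (4 * 10 ^ 8 * ε ^ 2))) (by positivity)
    (fun v => (hA v).trans (measure_mono fun ω ⟨t, ht, hopt⟩ => ⟨t, ht, by
      have := card_wrong_le hd hn (by positivity) hb v hopt
      refine this.trans (le_of_eq ?_)
      field_simp⟩)) fun v => (hlt v).le
  obtain ⟨T, h1, h2, h3⟩ := hdet (1 / 2000) (by norm_num)
  have hm : ∀ v, masses (fun _ : Fin n => biasedProb hd hb v) = fun _ => biasedMass (7 * ε) v := by
    intro v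
    funext i z
    exact finiteProb_real _ _ _ z
  simp only [hm] at h1 h2 h3
  have := le_of_mostly_correct hd hε hε1 hπ.le hπ1 (by linarith) q halt T out good
    (fun v θ hθ => hθ) h1 h2 h3
  refine absurd this (not_lt.2 (le_of_eq ?_))
  field_simp

end Dimension

/-! ### A change of measure, and defects of products -/

section Mixtures

open Classical in
/-- A change of measure argument. Under the weights `M k` few of the arms `(k, j)` are sampled more
than `B` times, and the weights `M k * g k j s` of the alternatives contradicted by the answers have
small total mass `β`; then the second moments `K` of the likelihood ratios must be large. -/
theorem sq_le_of_few_samples {ι : Type*} [DecidableEq ι] {m L : ℕ} (hm : 0 < m) (hL : 0 < L)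
    {H G : Finset ι} (hGH : G ⊆ H) {M : Fin m → ι → ℝ} {W : ι → ℝ} {g : Fin m → Fin L → Bool → ι → ℝ}
    {N : Fin m → Fin L → ι → ℝ} (answer : Fin m → ι → Bool) {η γ β S B K x : ℝ}
    (hM : ∀ k h, 0 ≤ M k h) (hMW : ∀ k h, M k h ≤ 3 * W h) (hg : ∀ k j s h, 0 < g k j s h)
    (hN : ∀ k j h, 0 ≤ N k j h) (hB : 0 < B) (hK : 0 < K)
    (hMsum : ∀ k, 1 - η ≤ ∑ h ∈ H, M k h) (hγ : ∑ h ∈ H \ G, W h ≤ γ)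
    (hS : ∑ h ∈ H, W h * ∑ k, ∑ j, N k j h ≤ S)
    (hβ : ∑ h ∈ G, ∑ k, M k h * ∑ j, g k j (answer k h) h ≤ 3 * L * (m * β))
    (hratio : ∀ k j s, ∑ h ∈ H.filter fun h => N k j h ≤ B, M k h * (g k j s h)⁻¹ ≤ K)
    (hx : 0 < x) (hx1 : x ≤ 1 - η - 3 * γ - 3 * S / (B * (m * L))) : x ^ 2 ≤ 6 * K * β := by
  have hm' : (0 : ℝ) < m := by positivity
  have hL' : (0 : ℝ) < L := by positivity
  -- Leaving `G` costs 3γ under each `M k`; being sampled more than `B` times is controlled by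
  -- Markov's inequality under `W`, averaged over the `m * L` arms. The factors 3 come from M ≤ 3W.
  have hlow : (m * L : ℝ) * x ≤ ∑ k, ∑ j, ∑ h ∈ G.filter fun h => N k j h ≤ B, M k h := by
    have a1 : ∀ k j, ∑ h ∈ H, M k h - 3 * ∑ h ∈ H \ G, W h - 3 / B * ∑ h ∈ H, W h * N k j h
        ≤ ∑ h ∈ G.filter fun h => N k j h ≤ B, M k h := by
      intro k j
      have b1 : ∑ h ∈ H, M k h = ∑ h ∈ H \ G, M k h + ∑ h ∈ G, M k h :=
        (Finset.sum_sdiff hGH).symm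
      have b2 : ∑ h ∈ H \ G, M k h ≤ 3 * ∑ h ∈ H \ G, W h := by
        rw [Finset.mul_sum]
        exact Finset.sum_le_sum fun h _ => hMW k h
      have b3 : ∑ h ∈ G, M k h = ∑ h ∈ G.filter (fun h => N k j h ≤ B), M k h
          + ∑ h ∈ G.filter (fun h => ¬ N k j h ≤ B), M k h :=
        (Finset.sum_filter_add_sum_filter_not _ _ _).symm
      have hWnn : ∀ h, 0 ≤ W h := fun h => by linarith [hM k h, hMW k h]
      have b4 : ∑ h ∈ G.filter (fun h => ¬ N k j h ≤ B), M k h ≤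
          3 / B * ∑ h ∈ H, W h * N k j h := by
        rw [Finset.mul_sum]
        refine le_trans (Finset.sum_le_sum fun h hh => ?_)
          (Finset.sum_le_sum_of_subset_of_nonneg
            ((Finset.filter_subset (fun h => ¬ N k j h ≤ B) _).trans hGH) fun h _ _ => ?_)
        · have c1 := (Finset.mem_filter.1 hh).2
          rw [not_le] at c1
          calc M k h ≤ 3 * W h := hMW k h
            _ ≤ 3 * W h * (N k j h / B) :=
              le_mul_of_one_le_right (by linarith [hWnn h]) ((one_le_div hB).2 c1.le)
            _ = _ := by ring
        · have := hWnn h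
          have := hN k j h
          positivity
      linarith
    have a2 : ∑ k : Fin m, ∑ j : Fin L, (1 - η - 3 * γ - 3 / B * ∑ h ∈ H, W h * N k j h)
        ≤ ∑ k, ∑ j, ∑ h ∈ G.filter fun h => N k j h ≤ B, M k h := by
      refine Finset.sum_le_sum fun k _ => Finset.sum_le_sum fun j _ => ?_
      refine le_trans ?_ (a1 k j)
      linarith [hMsum k]
    refine le_trans ?_ a2
    have a3 : ∑ k : Fin m, ∑ j : Fin L, ∑ h ∈ H, W h * N k j h ≤ S := by
      refine le_trans (le_of_eq ?_) hS
      simp only [Finset.mul_sum]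
      refine Eq.trans (Finset.sum_congr rfl fun k _ => Finset.sum_comm) Finset.sum_comm
    simp only [Finset.sum_sub_distrib, ← Finset.mul_sum, Finset.sum_const, Finset.card_univ,
      Fintype.card_fin, nsmul_eq_mul]
    have a4 : 3 / B * ∑ k : Fin m, ∑ j : Fin L, ∑ h ∈ H, W h * N k j h ≤ 3 / B * S := by gcongr
    have a5 : (m * L : ℝ) * (3 * S / (B * (m * L))) = 3 / B * S := by field_simp
    have a6 := mul_le_mul_of_nonneg_left hx1 (by positivity : (0 : ℝ) ≤ m * L)
    nlinarith
  -- Cauchy–Schwarz as 1 ≤ (t/2)g + 1/(2tg), with g the ratio of the contradicted alternative. The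
  -- answer varies with the history, so 1/g is replaced by its sum over both signs, hence 2K.
  have hup : ∀ t > 0, ∑ k, ∑ j, ∑ h ∈ G.filter (fun h => N k j h ≤ B), M k h
      ≤ t / 2 * (3 * L * (m * β)) + 1 / (2 * t) * (m * (L * (2 * K))) := by
    intro t ht
    have a1 : ∀ k j, ∑ h ∈ G.filter (fun h => N k j h ≤ B), M k h ≤
        t / 2 * ∑ h ∈ G, M k h * g k j (answer k h) h + 1 / (2 * t) * (2 * K) := by
      intro k j
      have b1 : ∀ h, M k h ≤ t / 2 * (M k h * g k j (answer k h) h) +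
          1 / (2 * t) * ∑ s, M k h * (g k j s h)⁻¹ := by
        intro h
        have c0 := hg k j (answer k h) h
        have c1 : M k h * (g k j (answer k h) h)⁻¹ ≤ ∑ s, M k h * (g k j s h)⁻¹ :=
          Finset.single_le_sum (f := fun s => M k h * (g k j s h)⁻¹)
            (fun s _ => mul_nonneg (hM k h) (inv_nonneg.2 (hg k j s h).le)) (Finset.mem_univ _)
        have c2 : 1 / (2 * t) * (M k h * (g k j (answer k h) h)⁻¹)
            ≤ 1 / (2 * t) * ∑ s, M k h * (g k j s h)⁻¹ := by gcongr
        refine le_trans ?_ (add_le_add_right c2 _)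
        have c3 : t / 2 * (M k h * g k j (answer k h) h) +
            1 / (2 * t) * (M k h * (g k j (answer k h) h)⁻¹) - M k h
            = M k h * ((t * g k j (answer k h) h - 1) ^ 2 / (2 * t * g k j (answer k h) h)) := by
          field_simp
          ring
        have c4 : 0 ≤ M k h * ((t * g k j (answer k h) h - 1) ^ 2 /
            (2 * t * g k j (answer k h) h)) :=
          mul_nonneg (hM k h) (by positivity)
        linarith
      calc _ ≤ ∑ h ∈ G.filter (fun h => N k j h ≤ B), (t / 2 * (M k h * g k j (answer k h) h) +
            1 / (2 * t) * ∑ s, M k h * (g k j s h)⁻¹) := Finset.sum_le_sum fun h _ => b1 h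
        _ = t / 2 * ∑ h ∈ G.filter (fun h => N k j h ≤ B), M k h * g k j (answer k h) h +
            1 / (2 * t) * ∑ s, ∑ h ∈ G.filter (fun h => N k j h ≤ B), M k h * (g k j s h)⁻¹ := by
            rw [Finset.sum_add_distrib, ← Finset.mul_sum, ← Finset.mul_sum]
            congr 2
            exact Finset.sum_comm
        _ ≤ _ := by
            gcongr ?_ + _ * ?_
            · refine mul_le_mul_of_nonneg_left ?_ (by positivity)
              exact Finset.sum_le_sum_of_subset_of_nonneg (Finset.filter_subset _ _)
                fun h _ _ => mul_nonneg (hM k h) (hg _ _ _ _).le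
            · rw [Fintype.sum_bool, two_mul]
              have : ∀ s, ∑ h ∈ G.filter (fun h => N k j h ≤ B), M k h * (g k j s h)⁻¹ ≤ K :=
                fun s => (Finset.sum_le_sum_of_subset_of_nonneg
                  (Finset.filter_subset_filter _ hGH) fun h _ _ =>
                    mul_nonneg (hM k h) (inv_nonneg.2 (hg k j s h).le)).trans (hratio k j s)
              exact add_le_add (this _) (this _)
    calc _ ≤ ∑ k, ∑ j, (t / 2 * ∑ h ∈ G, M k h * g k j (answer k h) h + 1 / (2 * t) * (2 * K)) :=
          Finset.sum_le_sum fun k _ => Finset.sum_le_sum fun j _ => a1 k j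
      _ = t / 2 * (∑ h ∈ G, ∑ k, M k h * ∑ j, g k j (answer k h) h)
          + 1 / (2 * t) * (m * (L * (2 * K))) := by
          have b1 : ∑ h ∈ G, ∑ k, M k h * ∑ j, g k j (answer k h) h
              = ∑ k, ∑ j, ∑ h ∈ G, M k h * g k j (answer k h) h := by
            rw [Finset.sum_comm]
            refine Finset.sum_congr rfl fun k _ => ?_
            rw [Finset.sum_comm]
            exact Finset.sum_congr rfl fun h _ => Finset.mul_sum _ _ _
          rw [b1]
          simp only [Finset.sum_add_distrib, ← Finset.mul_sum, Finset.sum_const, Finset.card_univ,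
            Fintype.card_fin, nsmul_eq_mul]
          ring
      _ ≤ _ := by gcongr
  -- This `t` makes the second-moment term half of the lower bound.
  have h1 := hlow.trans (hup (2 * K / x) (by positivity))
  have h2 : 2 * K / x / 2 * (3 * L * (m * β)) + 1 / (2 * (2 * K / x)) * (m * (L * (2 * K)))
      = (m * L) * (3 * K * β / x + x / 2) := by
    field_simp
  rw [h2] at h1
  have h3 := le_of_mul_le_mul_left h1 (by positivity)
  have h4 : x / 2 ≤ 3 * K * β / x := by linarith
  rw [le_div_iff₀ hx] at h4
  nlinarith

/-- If a product of the numbers `A k ≤ B k` is at least half the product of the `B k`, then the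
defects add up to at most twice the defect of the product. -/
theorem sum_prod_erase_mul_sub_le {m : ℕ} {A B : Fin m → ℝ} (hA : ∀ k, 0 ≤ A k)
    (hB : ∀ k, 0 < B k) (hAB : ∀ k, A k ≤ B k) (hhalf : (∏ k, B k) / 2 ≤ ∏ k, A k) :
    ∑ k, (∏ l ∈ Finset.univ.erase k, B l) * (B k - A k) ≤ 2 * (∏ k, B k - ∏ k, A k) := by
  have hBp : 0 < ∏ k, B k := Finset.prod_pos fun k _ => hB k
  set y : ℝ := (∏ k, A k) / ∏ k, B k with hy
  have hy1 : 1 / 2 ≤ y := by rw [hy, le_div_iff₀ hBp]; linarith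
  have h1 : ∀ k, (∏ l ∈ Finset.univ.erase k, B l) * (B k - A k)
      = (∏ l, B l) * (1 - A k / B k) := by
    intro k
    rw [← Finset.prod_erase_mul _ _ (Finset.mem_univ k)]
    have := (hB k).ne'
    field_simp
  simp only [h1]
  rw [← Finset.mul_sum]
  -- The relative defects add up to at most -log y, and -log y ≤ 1/y - 1 ≤ 2(1 - y) because 1/2 ≤ y
  -- ≤ 1.
  have h2 : y ≤ Real.exp (-∑ k, (1 - A k / B k)) := by
    rw [← Finset.sum_neg_distrib, Real.exp_sum, hy, ← Finset.prod_div_distrib]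
    refine Finset.prod_le_prod (fun k _ => div_nonneg (hA k) (hB k).le) fun k _ => ?_
    have := Real.add_one_le_exp (-(1 - A k / B k))
    linarith
  have h3 : ∑ k, (1 - A k / B k) ≤ 2 * (1 - y) := by
    have h4 : Real.log y ≤ -∑ k, (1 - A k / B k) := by
      rw [← Real.log_exp (-∑ k, (1 - A k / B k))]
      exact Real.log_le_log (by linarith) h2
    have h5 : 1 - y⁻¹ ≤ Real.log y := Real.one_sub_inv_le_log_of_pos (by linarith)
    have h6 : y⁻¹ - 1 ≤ 2 * (1 - y) := by
      have : y⁻¹ - 1 = (1 - y) * y⁻¹ := by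
        have : y ≠ 0 := by linarith
        field_simp
      have h7 : y⁻¹ ≤ 2 := by
        rw [inv_le_comm₀ (by linarith) (by norm_num)]; linarith
      have hy2 : y ≤ 1 :=
        (div_le_one hBp).2 (Finset.prod_le_prod (fun k _ => hA k) fun k _ => hAB k)
      rw [this]
      nlinarith
    linarith
  calc _ ≤ (∏ l, B l) * (2 * (1 - y)) := by gcongr
    _ = _ := by rw [hy]; field_simp

end Mixtures

/-! ### Blocks of groups with hidden special groups -/

section Needles

variable {d m L n : ℕ}

/-- A distribution of datapoints of coordinate `k` with average loss `1 / 4`. -/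
def nullMass (k : Fin d) : Option (Fin d × Bool) → ℝ
  | none => 1 / 2
  | some (j, _) => if j = k then 1 / 4 else 0

/-- The density with respect to `nullMass k` of a distribution which moves the mass `a` from the
datapoint `none` to `(k, s)`. -/
def specialRatio (a : ℝ) (k : Fin d) (s : Bool) : Option (Fin d × Bool) → ℝ
  | none => 1 - 2 * a
  | some (j, t) => if j = k ∧ t = s then 1 + 4 * a else 1

theorem specialRatio_pos {a : ℝ} (ha : 0 ≤ a) (ha1 : a ≤ 3 / 8) (k : Fin d) (s : Bool)
    (z : Option (Fin d × Bool)) : 0 < specialRatio a k s z := by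
  rcases z with _ | ⟨j, t⟩
  · simp only [specialRatio]; linarith
  · simp only [specialRatio]
    split_ifs <;> linarith

theorem nullMass_nonneg (k : Fin d) (z : Option (Fin d × Bool)) : 0 ≤ nullMass k z := by
  rcases z with _ | ⟨j, t⟩
  · simp only [nullMass]; norm_num
  · simp only [nullMass]
    split_ifs <;> norm_num

theorem sum_nullMass_mul (k : Fin d) (f : Option (Fin d × Bool) → ℝ) :
    ∑ z, nullMass k z * f z
      = 1 / 2 * f none + (1 / 4 * f (some (k, true)) + 1 / 4 * f (some (k, false))) := by
  rw [Fintype.sum_option, Fintype.sum_prod_type, Finset.sum_eq_single k]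
  · simp [nullMass]
  · intro j _ hj
    simp [nullMass, hj]
  · simp

theorem sum_nullMass (k : Fin d) : ∑ z, nullMass k z = 1 := by
  have := sum_nullMass_mul k fun _ => 1
  simp only [mul_one] at this
  rw [this]
  norm_num

theorem sum_nullMass_mul_specialRatio (a : ℝ) (k : Fin d) (s : Bool) :
    ∑ z, nullMass k z * specialRatio a k s z = 1 := by
  rw [sum_nullMass_mul]
  cases s <;> simp [specialRatio] <;> ring

/-- The expected inverse ratio is 1 + 6a²/((1 - 2a)(1 + 4a)), and the denominator is at least 1/4 in
this range of `a`. -/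
theorem sum_nullMass_mul_inv_specialRatio_le {a : ℝ} (ha : 0 ≤ a) (ha1 : a ≤ 3 / 8) (k : Fin d)
    (s : Bool) :
    ∑ z, nullMass k z * ((specialRatio a k s z)⁻¹ * (1 + 24 * a ^ 2)⁻¹) ≤ 1 := by
  simp only [← mul_assoc, ← Finset.sum_mul]
  rw [← div_eq_mul_inv, div_le_one (by positivity), sum_nullMass_mul]
  have h1 : 0 < 1 - 2 * a := by linarith
  have h2 : 0 < 1 + 4 * a := by linarith
  have key : 1 / 2 * (1 - 2 * a)⁻¹ + (1 / 4 * (1 + 4 * a)⁻¹ + 1 / 4) ≤ 1 + 24 * a ^ 2 := by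
    have e : 1 / 2 * (1 - 2 * a)⁻¹ + (1 / 4 * (1 + 4 * a)⁻¹ + 1 / 4)
        = 1 + 6 * a ^ 2 / ((1 - 2 * a) * (1 + 4 * a)) := by
      field_simp
      ring
    have h3 : 6 * a ^ 2 / ((1 - 2 * a) * (1 + 4 * a)) ≤ 24 * a ^ 2 := by
      rw [div_le_iff₀ (by positivity)]
      have : 1 / 4 ≤ (1 - 2 * a) * (1 + 4 * a) := by nlinarith
      nlinarith [sq_nonneg a]
    linarith
  cases s
  · simp [specialRatio] at key ⊢; linarith
  · simp [specialRatio] at key ⊢; linarith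

/-- The density of the datapoint `z` of oracle `i` when, among the oracles `arms`, at most one is
special. -/
def armRatio (a : ℝ) (k : Fin d) (arms : Fin L → Fin n) :
    Option (Fin L × Bool) → Fin n → Option (Fin d × Bool) → ℝ
  | none, _, _ => 1
  | some (j, s), i, z => if i = arms j then specialRatio a k s z else 1

theorem armRatio_pos {a : ℝ} (ha : 0 ≤ a) (ha1 : a ≤ 3 / 8) (k : Fin d) (arms : Fin L → Fin n)
    (c : Option (Fin L × Bool)) (i : Fin n) (z : Option (Fin d × Bool)) :
    0 < armRatio a k arms c i z := by
  rcases c with _ | ⟨j, s⟩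
  · exact one_pos
  · simp only [armRatio]
    split_ifs
    · exact specialRatio_pos ha ha1 k s z
    · exact one_pos

/-- The oracles are divided into blocks, with a coordinate `coord k` for each block `k`; some of the
oracles of the block `k` are listed by `arm k`. -/
structure Blocks (d m L n : ℕ) where
  coord : Fin m → Fin d
  block : Fin n → Fin m
  arm : Fin m → Fin L → Fin n
  coord_injective : Function.Injective coord
  block_arm : ∀ k j, block (arm k j) = k
  arm_injective : ∀ k, Function.Injective (arm k)

/-- The masses of the data distributions when the special oracle of each block, if there is one, is
given by `C`. -/
def Blocks.mass (b : Blocks d m L n) (a : ℝ) (C : Fin m → Option (Fin L × Bool)) (i : Fin n)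
    (z : Option (Fin d × Bool)) : ℝ :=
  nullMass (b.coord (b.block i)) z * ∏ k, armRatio a (b.coord k) (b.arm k) (C k) i z

/-- The arms listed for a block lie in that block, so the factors of all other blocks are 1. The
product over blocks is kept in the definition so that likelihoods factorize. -/
theorem Blocks.mass_eq (b : Blocks d m L n) (a : ℝ) (C : Fin m → Option (Fin L × Bool)) (i : Fin n)
    (z : Option (Fin d × Bool)) : b.mass a C i z = nullMass (b.coord (b.block i)) z *
      armRatio a (b.coord (b.block i)) (b.arm (b.block i)) (C (b.block i)) i z := by
  rw [Blocks.mass, Finset.prod_eq_single (b.block i)]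
  · intro k _ hk
    rcases C k with _ | ⟨j, s⟩
    · rfl
    · rw [armRatio, if_neg]
      rintro rfl
      exact hk (b.block_arm k j).symm
  · simp

theorem Blocks.mass_nonneg (b : Blocks d m L n) {a : ℝ} (ha : 0 ≤ a) (ha1 : a ≤ 3 / 8)
    (C : Fin m → Option (Fin L × Bool)) (i : Fin n) (z : Option (Fin d × Bool)) :
    0 ≤ b.mass a C i z :=
  mul_nonneg (nullMass_nonneg _ _)
    (Finset.prod_nonneg fun _ _ => (armRatio_pos ha ha1 _ _ _ _ _).le)

theorem Blocks.sum_mass (b : Blocks d m L n) (a : ℝ) (C : Fin m → Option (Fin L × Bool))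
    (i : Fin n) : ∑ z, b.mass a C i z = 1 := by
  simp only [b.mass_eq]
  rcases C (b.block i) with _ | ⟨j, s⟩
  · simp only [armRatio, mul_one]
    exact sum_nullMass _
  · simp only [armRatio]
    split_ifs
    · exact sum_nullMass_mul_specialRatio _ _ _
    · simp only [mul_one]
      exact sum_nullMass _

/-- The data distributions with the masses `b.mass a C`. -/
def Blocks.prob (b : Blocks d m L n) {a : ℝ} (ha : 0 ≤ a) (ha1 : a ≤ 3 / 8)
    (C : Fin m → Option (Fin L × Bool)) (i : Fin n) : ProbabilityMeasure (Option (Fin d × Bool)) :=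
  finiteProb (b.mass a C i) (b.mass_nonneg ha ha1 C i) (b.sum_mass a C i)

theorem Blocks.risk_prob (b : Blocks d m L n) {a : ℝ} (ha : 0 ≤ a) (ha1 : a ≤ 3 / 8)
    (C : Fin m → Option (Fin L × Bool)) (i : Fin n) (θ : Fin d → ℝ) :
    (cubeModel d).risk (b.prob ha ha1 C i) θ = 1 / 4 + match C (b.block i) with
      | none => 0
      | some (j, s) => if i = b.arm (b.block i) j then
          a * (sgn s * θ (b.coord (b.block i)) + 1 / 2) else 0 := by
  rw [Blocks.prob, risk_cubeModel, Finset.sum_eq_single (b.coord (b.block i))]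
  · simp only [b.mass_eq]
    rcases C (b.block i) with _ | ⟨j, s⟩
    · simp [armRatio, nullMass]; ring
    · simp only [armRatio]
      split_ifs
      · cases s <;> simp [nullMass, specialRatio] <;> ring
      · simp [nullMass]; ring
  · intro k _ hk
    simp [b.mass_eq, nullMass, hk]
  · simp

/-- An almost optimal parameter identifies the sign of the special oracle in every block. -/
theorem Blocks.ne_of_isEpsOptimal (b : Blocks d m L n) {ε : ℝ} (ha : 0 ≤ 3 * ε)
    (ha1 : 3 * ε ≤ 3 / 8) (hε : 0 < ε) (C : Fin m → Option (Fin L × Bool)) {θ : Fin d → ℝ}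
    (hθ : (cubeModel d).IsEpsOptimal (b.prob ha ha1 C) ε θ) (k : Fin m) (j : Fin L) :
    C k ≠ some (j, decide (0 ≤ θ (b.coord k))) := by
  intro hC
  have : Nonempty (Fin n) := ⟨b.arm k j⟩
  obtain ⟨-, hθ⟩ := hθ
  -- Distinct blocks own distinct coordinates, so one vertex opposes all special signs at once and
  -- the optimum is at most 1/4. Agreeing with one special sign costs at least 3ε/2 > ε more.
  let u : Fin m → Bool := fun k => match C k with
    | none => true
    | some (_, s) => s
  let v : Fin d → Bool := Function.extend b.coord u fun _ => true
  have hopt := opt_le (cubeModel d) (b.prob ha ha1 C) (mul_sgn_mem_cube v)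
  have h1 : (cubeModel d).worstRisk (b.prob ha ha1 C) (fun j => -(sgn (v j) / 2)) ≤ 1 / 4 := by
    refine ciSup_le fun i => ?_
    rw [b.risk_prob]
    have hv : v (b.coord (b.block i)) = u (b.block i) := b.coord_injective.extend_apply _ _ _
    rw [hv]
    simp only [u]
    rcases C (b.block i) with _ | ⟨j', s⟩
    · simp
    · simp only
      split_ifs
      · cases s <;> norm_num
      · norm_num
  have h2 := risk_le_worstRisk (cubeModel d) (b.prob ha ha1 C) θ (b.arm k j)
  rw [b.risk_prob, b.block_arm, hC] at h2
  simp only [if_true] at h2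
  have h3 : 0 ≤ sgn (decide (0 ≤ θ (b.coord k))) * θ (b.coord k) := by
    by_cases h : 0 ≤ θ (b.coord k)
    · simp [h]
    · simp [h]; linarith
  nlinarith

/-- A partition of the oracles into blocks. -/
def Blocks.ofLe (hm : 0 < m) (hmd : m ≤ d) (hmL : m * L ≤ n) : Blocks d m L n where
  coord := Fin.castLE hmd
  -- Blocks are residue classes modulo `m`. Oracles from `m * L` on belong to a block but are not
  -- listed as arms, so they are never special.
  block := fun i => ⟨i % m, Nat.mod_lt _ hm⟩
  arm := fun k j => ⟨k + m * j, by
    calc k + m * j < m * (j + 1) := by rw [mul_add]; omega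
      _ ≤ m * L := Nat.mul_le_mul_left m j.is_lt
      _ ≤ n := hmL⟩
  coord_injective := Fin.castLE_injective hmd
  block_arm := fun k j => by
    ext
    simp [Nat.mod_eq_of_lt k.is_lt]
  arm_injective := fun _ j j' h => by
    simp only [Fin.mk.injEq, Nat.add_left_cancel_iff] at h
    exact Fin.ext (Nat.eq_of_mul_eq_mul_left hm h)

end Needles

/-! ### Product priors and the factorized posterior -/

section Needles

variable {d m L n : ℕ} (b : Blocks d m L n) (a : ℝ)
  (q : ∀ t, (Fin t → Option (Fin d × Bool)) → Fin n)

/-- The likelihood ratio of the alternative `c` for the block `k`. -/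
def Blocks.ratio (k : Fin m) (c : Option (Fin L × Bool)) (h : Hist (Option (Fin d × Bool))) : ℝ :=
  weight q (armRatio a (b.coord k) (b.arm k) c) h

/-- The probability of a history when no oracle is special. -/
def Blocks.nullWeight (h : Hist (Option (Fin d × Bool))) : ℝ :=
  weight q (fun i z => nullMass (b.coord (b.block i)) z) h

theorem Blocks.weight_mass (C : Fin m → Option (Fin L × Bool)) (h : Hist (Option (Fin d × Bool))) :
    weight q (b.mass a C) h = b.nullWeight q h * ∏ k, b.ratio a q k (C k) h := by
  unfold Blocks.mass Blocks.nullWeight Blocks.ratio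
  rw [weight_mul, weight_prod]

/-- A mixture over a product prior is a product of mixtures. -/
theorem Blocks.sum_prod_mul_weight (u : Fin m → Option (Fin L × Bool) → ℝ)
    (h : Hist (Option (Fin d × Bool))) :
    ∑ C : Fin m → Option (Fin L × Bool), (∏ k, u k (C k)) * weight q (b.mass a C) h
      = b.nullWeight q h * ∏ k, ∑ c, u k c * b.ratio a q k c h := by
  rw [Fintype.prod_sum, Finset.mul_sum]
  refine Finset.sum_congr rfl fun C _ => ?_
  rw [b.weight_mass, Finset.prod_mul_distrib]
  ring

/-- The prior distribution of the special oracle of a block. -/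
def blockPrior (L : ℕ) : Option (Fin L × Bool) → ℝ
  | none => 1 / 3
  | some _ => 1 / (3 * L)

theorem blockPrior_pos (hL : 0 < L) (c : Option (Fin L × Bool)) : 0 < blockPrior L c := by
  rcases c with _ | c
  · norm_num [blockPrior]
  · have : (0 : ℝ) < L := by positivity
    simp only [blockPrior]
    positivity

theorem sum_blockPrior (hL : 0 < L) : ∑ c, blockPrior L c = 1 := by
  have : (L : ℝ) ≠ 0 := by positivity
  rw [Fintype.sum_option]
  simp [blockPrior]
  field_simp
  norm_num

variable {a q}

theorem Blocks.ratio_pos (ha : 0 ≤ a) (ha1 : a ≤ 3 / 8) (k : Fin m) (c : Option (Fin L × Bool))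
    (h : Hist (Option (Fin d × Bool))) : 0 < b.ratio a q k c h := by
  unfold Blocks.ratio weight
  exact Finset.prod_pos fun _ _ => armRatio_pos ha ha1 _ _ _ _ _

theorem Blocks.ratio_none (k : Fin m) (h : Hist (Option (Fin d × Bool))) :
    b.ratio a q k none h = 1 := by
  simp [Blocks.ratio, weight, armRatio]

theorem Blocks.nullWeight_nonneg (h : Hist (Option (Fin d × Bool))) : 0 ≤ b.nullWeight q h :=
  weight_nonneg (fun _ z => nullMass_nonneg _ z) h

theorem Blocks.sum_tally_arm_le (h : Hist (Option (Fin d × Bool))) :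
    ∑ k, ∑ j, (tally q (fun i _ => i = b.arm k j) h : ℝ) ≤ h.1 := by
  have := sum_tally_le (q := q) (Z := Option (Fin d × Bool)) Finset.univ
    (fun (p : Fin m × Fin L) i _ => i = b.arm p.1 p.2)
    (fun i z p _ p' _ hp hp' => by
      obtain ⟨k, j⟩ := p
      obtain ⟨k', j'⟩ := p'
      simp only at hp hp'
      have hk : k = k' := by
        rw [← b.block_arm k j, ← b.block_arm k' j', ← hp, ← hp']
      subst hk
      rw [b.arm_injective k (hp.symm.trans hp')]) h
  rw [Fintype.sum_prod_type] at this
  exact_mod_cast this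

open Classical in
/-- A second moment bound for the likelihood ratio of a special oracle, restricted to few samples
of that oracle. -/
theorem Blocks.sum_weight_mul_inv_ratio_le (ha : 0 ≤ a) (ha1 : a ≤ 3 / 8)
    {C : Fin m → Option (Fin L × Bool)} {k : Fin m} (hC : C k = none) (j : Fin L) (s : Bool)
    (halt : ∀ t, Set (Fin t → Option (Fin d × Bool))) (T : ℕ) (B : ℝ) :
    ∑ h ∈ (terminal halt T).filter fun h => (tally q (fun i _ => i = b.arm k j) h : ℝ) ≤ B,
      weight q (b.mass a C) h * (b.ratio a q k (some (j, s)) h)⁻¹ ≤ (1 + 24 * a ^ 2) ^ B := by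
  set κ : ℝ := 1 + 24 * a ^ 2 with hκ
  have hκ1 : 1 ≤ κ := by rw [hκ]; nlinarith [sq_nonneg a]
  let R : Fin n → Option (Fin d × Bool) → ℝ := fun i z => b.mass a C i z *
    ((armRatio a (b.coord k) (b.arm k) (some (j, s)) i z)⁻¹ *
      if i = b.arm k j then κ⁻¹ else 1)
  have hR0 : ∀ i z, 0 ≤ R i z := fun i z => by
    refine mul_nonneg (b.mass_nonneg ha ha1 C i z) (mul_nonneg
      (inv_nonneg.2 (armRatio_pos ha ha1 _ _ _ _ _).le) ?_)
    split_ifs <;> positivity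
  have hR1 : ∀ i, ∑ z, R i z ≤ 1 := by
    intro i
    -- Since block `k` has no special oracle under `C`, this arm has the null masses, so the null
    -- second moment applies; the other arms are untouched by the alternative.
    by_cases hi : i = b.arm k j
    · subst hi
      simp only [R, b.mass_eq, b.block_arm, hC, armRatio, if_true, mul_one]
      exact sum_nullMass_mul_inv_specialRatio_le ha ha1 _ _
    · simp only [R, armRatio, if_neg hi, inv_one, mul_one]
      exact (b.sum_mass a C i).le
  have hwR : ∀ h, weight q R h = weight q (b.mass a C) h * (b.ratio a q k (some (j, s)) h)⁻¹ *
      κ⁻¹ ^ tally q (fun i _ => i = b.arm k j) h := by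
    intro h
    simp only [R]
    rw [weight_mul, weight_mul, ← mul_assoc]
    congr 1
    · congr 1
      exact Finset.prod_inv_distrib _
    · convert weight_ite (q := q) (fun i _ => i = b.arm k j) κ⁻¹ h
  calc _ ≤ ∑ h ∈ (terminal halt T).filter fun h =>
        (tally q (fun i _ => i = b.arm k j) h : ℝ) ≤ B, weight q R h * κ ^ B := by
        refine Finset.sum_le_sum fun h hh => ?_
        have h1 := (Finset.mem_filter.1 hh).2
        rw [hwR, mul_assoc]
        refine le_mul_of_one_le_right (mul_nonneg (weight_nonneg (b.mass_nonneg ha ha1 C) _)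
          (inv_nonneg.2 (b.ratio_pos ha ha1 _ _ _).le)) ?_
        rw [inv_pow, ← Real.rpow_natCast, ← Real.rpow_neg (by linarith),
          ← Real.rpow_add (by linarith)]
        exact Real.one_le_rpow hκ1 (by linarith)
    _ ≤ ∑ h ∈ terminal halt T, weight q R h * κ ^ B :=
        Finset.sum_le_sum_of_subset_of_nonneg (Finset.filter_subset _ _) fun h _ _ =>
          mul_nonneg (weight_nonneg hR0 h) (by positivity)
    _ ≤ 1 * κ ^ B := by
        rw [← Finset.sum_mul]
        gcongr
        exact sum_weight_terminal_le_one hR0 hR1 halt T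
    _ = _ := one_mul _

/-- The parameters which, in every block, have a sign different from that of the special oracle. -/
def Blocks.good (C : Fin m → Option (Fin L × Bool)) : Set (Fin d → ℝ) :=
  {θ | ∀ k j, C k ≠ some (j, decide (0 ≤ θ (b.coord k)))}

open Classical in
/-- A deterministic algorithm which on average finds the signs of the special oracles needs many
samples. -/
theorem Blocks.sq_le_of_mostly_correct (hm : 0 < m) (hL : 0 < L) (ha : 0 ≤ a) (ha1 : a ≤ 3 / 8)
    (halt : ∀ t, Set (Fin t → Option (Fin d × Bool))) (T : ℕ)
    (out : Hist (Option (Fin d × Bool)) → Fin d → ℝ) {η δ S B x γ β : ℝ} (hB : 0 < B)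
    (h1 : ∀ C, 1 - η ≤ ∑ h ∈ terminal halt T, weight q (b.mass a C) h)
    (h2 : ∑ C, (∏ k, blockPrior L (C k)) *
      ∑ h ∈ terminal halt T, weight q (b.mass a C) h * h.1 ≤ S)
    (h3 : ∑ C, (∏ k, blockPrior L (C k)) *
      ∑ h ∈ (terminal halt T).filter fun h => out h ∉ b.good C, weight q (b.mass a C) h ≤ δ)
    (hγβ : (m = 1 ∧ γ = 0 ∧ β = δ) ∨ (γ = 2 * δ ∧ β = 2 * δ / m))
    (hx : 0 < x) (hx1 : x ≤ 1 - η - 3 * γ - 3 * S / (B * (m * L))) :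
    x ^ 2 ≤ 6 * (1 + 24 * a ^ 2) ^ B * β := by
  have hm' : (0 : ℝ) < m := by positivity
  have hL' : (0 : ℝ) < L := by positivity
  let answer : Fin m → Hist (Option (Fin d × Bool)) → Bool :=
    fun k h => decide (0 ≤ out h (b.coord k))
  let ok : Fin m → Hist (Option (Fin d × Bool)) → Option (Fin L × Bool) → ℝ :=
    fun k h c => if ∃ j, c = some (j, answer k h) then 0 else 1
  let P : Fin m → Hist (Option (Fin d × Bool)) → ℝ :=
    fun k h => ∑ c, blockPrior L c * b.ratio a q k c h
  let A : Fin m → Hist (Option (Fin d × Bool)) → ℝ :=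
    fun k h => ∑ c, blockPrior L c * ok k h c * b.ratio a q k c h
  let W : Hist (Option (Fin d × Bool)) → ℝ := fun h => b.nullWeight q h * ∏ k, P k h
  let V : Hist (Option (Fin d × Bool)) → ℝ := fun h => b.nullWeight q h * ∏ k, A k h
  let M : Fin m → Hist (Option (Fin d × Bool)) → ℝ :=
    fun k h => b.nullWeight q h * ∏ l ∈ Finset.univ.erase k, P l h
  have hπ := fun c => (blockPrior_pos hL c).le
  have hr := fun k c h => b.ratio_pos (q := q) ha ha1 k c h
  have hw0 := fun C h => weight_nonneg (q := q) (b.mass_nonneg ha ha1 C) h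
  have hn0 := fun h => b.nullWeight_nonneg (q := q) h
  have hok : ∀ k h c, 0 ≤ ok k h c ∧ ok k h c ≤ 1 := by
    intro k h c
    simp only [ok]
    split_ifs <;> norm_num
  -- The prior mass 1/3 of "no special oracle", whose ratio is 1, bounds every block mixture from
  -- below. This is what gives M ≤ 3W.
  have hP3 : ∀ k h, 1 / 3 ≤ P k h := by
    intro k h
    have := Finset.single_le_sum (f := fun c => blockPrior L c * b.ratio a q k c h)
      (fun c _ => mul_nonneg (hπ c) (hr k c h).le) (Finset.mem_univ none)
    rw [b.ratio_none, mul_one] at this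
    exact this
  have hP0 : ∀ k h, 0 < P k h := fun k h => by linarith [hP3 k h]
  have hA0 : ∀ k h, 0 ≤ A k h := fun k h => Finset.sum_nonneg fun c _ =>
    mul_nonneg (mul_nonneg (hπ c) (hok k h c).1) (hr k c h).le
  have hAP : ∀ k h, A k h ≤ P k h := fun k h => Finset.sum_le_sum fun c _ =>
    mul_le_mul_of_nonneg_right (mul_le_of_le_one_right (hπ c) (hok k h c).2) (hr k c h).le
  have hPA : ∀ k h, ∑ j, b.ratio a q k (some (j, answer k h)) h = 3 * L * (P k h - A k h) := by
    intro k h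
    simp only [P, A]
    rw [← Finset.sum_sub_distrib, Fintype.sum_option, Fintype.sum_prod_type]
    have e1 : ok k h none = 1 := by simp [ok]
    have e2 : ∀ j s, ok k h (some (j, s)) = if s = answer k h then 0 else 1 := by
      intro j s
      simp [ok]
    rw [e1, mul_one, sub_self, zero_add, Finset.mul_sum]
    refine Finset.sum_congr rfl fun j _ => ?_
    rw [Finset.sum_eq_single (answer k h)]
    · rw [e2, if_pos rfl]
      simp only [blockPrior]
      field_simp
      ring
    · intro s _ hs
      rw [e2, if_neg hs]
      ring
    · simp
  have hMP : ∀ k h, M k h * P k h = W h := fun k h => by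
    simp only [M, W]
    rw [mul_assoc, Finset.prod_erase_mul _ _ (Finset.mem_univ k)]
  have hM0 : ∀ k h, 0 ≤ M k h := fun k h =>
    mul_nonneg (hn0 h) (Finset.prod_nonneg fun l _ => (hP0 l h).le)
  have hW : ∀ h, W h = ∑ C : Fin m → Option (Fin L × Bool),
      (∏ k, blockPrior L (C k)) * weight q (b.mass a C) h :=
    fun h => (b.sum_prod_mul_weight a q (fun _ => blockPrior L) h).symm
  -- Success is a conjunction of one condition per block, so the successful mass is again a product
  -- and W - V is exactly the failing mass.
  have hV : ∀ h, V h = ∑ C : Fin m → Option (Fin L × Bool),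
      (∏ k, blockPrior L (C k)) * (if out h ∈ b.good C then weight q (b.mass a C) h else 0) := by
    intro h
    refine (b.sum_prod_mul_weight a q (fun k c => blockPrior L c * ok k h c) h).symm.trans ?_
    refine Finset.sum_congr rfl fun C _ => ?_
    rw [Finset.prod_mul_distrib, mul_assoc]
    congr 1
    by_cases hC : out h ∈ b.good C
    · rw [if_pos hC, Finset.prod_eq_one, one_mul]
      intro k _
      exact if_neg fun ⟨j, hj⟩ => hC k j hj
    · rw [if_neg hC]
      have : ∃ k j, C k = some (j, answer k h) := by
        by_contra! hcon
        exact hC hcon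
      obtain ⟨k, hk⟩ := this
      rw [Finset.prod_eq_zero (Finset.mem_univ k), zero_mul]
      exact if_pos hk
  have hWV0 : ∀ h, 0 ≤ W h - V h := fun h => by
    have : V h ≤ W h := mul_le_mul_of_nonneg_left
      (Finset.prod_le_prod (fun k _ => hA0 k h) fun k _ => hAP k h) (hn0 h)
    linarith
  have hWV : ∑ h ∈ terminal halt T, (W h - V h) ≤ δ := by
    refine le_trans (le_of_eq ?_) h3
    simp only [Finset.mul_sum, Finset.sum_filter]
    rw [Finset.sum_comm]
    refine Finset.sum_congr rfl fun h _ => ?_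
    rw [hW, hV, ← Finset.sum_sub_distrib]
    refine Finset.sum_congr rfl fun C _ => ?_
    by_cases hC : out h ∈ b.good C <;> simp [hC]
  -- `M k` is itself a mixture, with block `k` forced to have no special oracle. Bounds valid for
  -- each such problem therefore pass to it.
  have hMmix : ∀ k h, M k h = ∑ C : Fin m → Option (Fin L × Bool),
      (∏ l, if l = k then (if C l = none then 1 else 0) else blockPrior L (C l)) *
        weight q (b.mass a C) h := by
    intro k h
    refine Eq.trans ?_ (b.sum_prod_mul_weight a q
      (fun l c => if l = k then (if c = none then 1 else 0) else blockPrior L c) h).symm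
    simp only [M]
    rw [← Finset.prod_erase_mul _ _ (Finset.mem_univ k)]
    have e1 : ∑ c, (if k = k then (if c = none then 1 else 0) else blockPrior L c) *
        b.ratio a q k c h = 1 := by
      simp [b.ratio_none]
    rw [e1, mul_one]
    congr 1
    refine Finset.prod_congr rfl fun l hl => ?_
    simp only [if_neg (Finset.ne_of_mem_erase hl), P]
  have hmix1 : ∀ k, ∑ C : Fin m → Option (Fin L × Bool),
      (∏ l, if l = k then (if C l = none then 1 else 0) else blockPrior L (C l)) = (1 : ℝ) := by
    intro k
    rw [← Fintype.prod_sum fun l (c : Option (Fin L × Bool)) =>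
      if l = k then (if c = none then (1 : ℝ) else 0) else blockPrior L c]
    refine Finset.prod_eq_one fun l _ => ?_
    by_cases hl : l = k
    · simp [hl]
    · simp only [if_neg hl]
      exact sum_blockPrior hL
  have hmix0 : ∀ k (C : Fin m → Option (Fin L × Bool)),
      0 ≤ (∏ l, if l = k then (if C l = none then (1 : ℝ) else 0) else blockPrior L (C l)) := by
    intro k C
    refine Finset.prod_nonneg fun l _ => ?_
    split_ifs
    · norm_num
    · norm_num
    · exact hπ _
  have hMsum : ∀ k, 1 - η ≤ ∑ h ∈ terminal halt T, M k h := by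
    intro k
    simp only [hMmix]
    rw [Finset.sum_comm]
    simp only [← Finset.mul_sum]
    calc 1 - η = ∑ C : Fin m → Option (Fin L × Bool),
        (∏ l, if l = k then (if C l = none then 1 else 0) else blockPrior L (C l)) * (1 - η) := by
          rw [← Finset.sum_mul, hmix1, one_mul]
      _ ≤ _ := Finset.sum_le_sum fun C _ => mul_le_mul_of_nonneg_left (h1 C) (hmix0 k C)
  have hratio : ∀ k j s, ∑ h ∈ (terminal halt T).filter fun h =>
      (tally q (fun i _ => i = b.arm k j) h : ℝ) ≤ B,
      M k h * (b.ratio a q k (some (j, s)) h)⁻¹ ≤ (1 + 24 * a ^ 2) ^ B := by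
    intro k j s
    simp only [hMmix, Finset.sum_mul]
    rw [Finset.sum_comm]
    simp only [mul_assoc, ← Finset.mul_sum]
    calc _ ≤ ∑ C : Fin m → Option (Fin L × Bool),
        (∏ l, if l = k then (if C l = none then 1 else 0) else blockPrior L (C l)) *
          (1 + 24 * a ^ 2) ^ B := by
          refine Finset.sum_le_sum fun C _ => ?_
          by_cases hC : C k = none
          · exact mul_le_mul_of_nonneg_left
              (b.sum_weight_mul_inv_ratio_le ha ha1 hC j s halt T B) (hmix0 k C)
          · rw [Finset.prod_eq_zero (Finset.mem_univ k) (by simp [hC]), zero_mul, zero_mul]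
      _ = _ := by rw [← Finset.sum_mul, hmix1, one_mul]
  have hS : ∑ h ∈ terminal halt T, W h *
      ∑ k, ∑ j, (tally q (fun i _ => i = b.arm k j) h : ℝ) ≤ S := by
    refine le_trans (le_trans (Finset.sum_le_sum fun h _ => mul_le_mul_of_nonneg_left
      (b.sum_tally_arm_le h) ?_) (le_of_eq ?_)) h2
    · rw [← hMP ⟨0, hm⟩ h]
      exact mul_nonneg (hM0 _ _) (hP0 _ _).le
    · simp only [hW, Finset.sum_mul, Finset.mul_sum]
      rw [Finset.sum_comm]
      simp only [mul_assoc]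
  have hMW : ∀ k h, M k h ≤ 3 * W h := fun k h => by
    rw [← hMP k h]
    nlinarith [hM0 k h, hP3 k h]
  have main : ∀ G ⊆ terminal halt T, ∑ h ∈ terminal halt T \ G, W h ≤ γ →
      (∑ h ∈ G, ∑ k, M k h * (P k h - A k h) ≤ m * β) → x ^ 2 ≤ 6 * (1 + 24 * a ^ 2) ^ B * β := by
    intro G hG hγ hβ
    refine sq_le_of_few_samples hm hL hG (g := fun k j s h => b.ratio a q k (some (j, s)) h)
      (N := fun k j h => (tally q (fun i _ => i = b.arm k j) h : ℝ)) answer hM0 hMW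
      (fun k j s h => hr k _ h) (fun _ _ _ => Nat.cast_nonneg _) hB (by positivity) hMsum hγ hS ?_
      hratio hx hx1
    simp only [hPA]
    calc _ = 3 * L * ∑ h ∈ G, ∑ k, M k h * (P k h - A k h) := by
          simp only [Finset.mul_sum]
          refine Finset.sum_congr rfl fun h _ => Finset.sum_congr rfl fun k _ => by ring
      _ ≤ _ := by gcongr
  -- For a single block, M(P - A) equals W - V and nothing is lost, which is needed when δ is near
  -- 1/8. For several blocks a factor 2 is lost, both in the discarded mass and in the defect bound.
  rcases hγβ with ⟨rfl, rfl, rfl⟩ | ⟨rfl, rfl⟩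
  · refine main _ subset_rfl (by simp) ?_
    refine le_trans (le_of_eq ?_) (hWV.trans (le_of_eq (by simp)))
    refine Finset.sum_congr rfl fun h _ => ?_
    simp only [M, W, V, Finset.univ_unique, Finset.sum_singleton, Finset.prod_singleton]
    simp
    ring
  -- Keep the histories whose posterior success probability is at least 1/2. On the others W < 2(W -
  -- V), so their mass is at most 2δ.
  · refine main ((terminal halt T).filter fun h => W h / 2 ≤ V h) (Finset.filter_subset _ _) ?_ ?_
    · rw [← Finset.filter_not]
      calc _ ≤ ∑ h ∈ (terminal halt T).filter fun h => ¬ W h / 2 ≤ V h, 2 * (W h - V h) := by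
            refine Finset.sum_le_sum fun h hh => ?_
            have := (Finset.mem_filter.1 hh).2
            linarith
        _ ≤ ∑ h ∈ terminal halt T, 2 * (W h - V h) :=
            Finset.sum_le_sum_of_subset_of_nonneg (Finset.filter_subset _ _) fun h _ _ => by
              linarith [hWV0 h]
        _ ≤ _ := by
            rw [← Finset.mul_sum]
            linarith
    · calc _ ≤ ∑ h ∈ (terminal halt T).filter fun h => W h / 2 ≤ V h, 2 * (W h - V h) := by
            refine Finset.sum_le_sum fun h hh => ?_
            have h4 := (Finset.mem_filter.1 hh).2
            simp only [M, W, V] at h4 ⊢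
            rcases (hn0 h).eq_or_lt with h0 | h0
            · simp [← h0]
            · have h5 : (∏ k, P k h) / 2 ≤ ∏ k, A k h := by
                refine le_of_mul_le_mul_left ?_ h0
                linarith
              have h6 := mul_le_mul_of_nonneg_left (sum_prod_erase_mul_sub_le
                (fun k => hA0 k h) (fun k => hP0 k h) (fun k => hAP k h) h5) h0.le
              rw [Finset.mul_sum] at h6
              simp only [mul_assoc] at h6 ⊢
              linarith
        _ ≤ ∑ h ∈ terminal halt T, 2 * (W h - V h) :=
            Finset.sum_le_sum_of_subset_of_nonneg (Finset.filter_subset _ _) fun h _ _ => by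
              linarith [hWV0 h]
        _ ≤ _ := by
            rw [← Finset.mul_sum]
            have : (m : ℝ) * (2 * δ / m) = 2 * δ := by field_simp
            linarith

end Needles

/-! ### The term n log(m/δ), with constants -/

section Groups

variable {d m L n : ℕ}

theorem Blocks.measurableSet_good (b : Blocks d m L n) (C : Fin m → Option (Fin L × Bool)) :
    MeasurableSet (b.good C) := by
  have e : b.good C = ⋂ k, ⋂ j, {θ | C k ≠ some (j, decide (0 ≤ θ (b.coord k)))} := by
    ext θ
    simp [Blocks.good]
  rw [e]
  refine MeasurableSet.iInter fun k => MeasurableSet.iInter fun j => ?_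
  have h1 : MeasurableSet {θ : Fin d → ℝ | 0 ≤ θ (b.coord k)} :=
    measurableSet_le measurable_const (measurable_pi_apply _)
  have h2 : {θ : Fin d → ℝ | C k ≠ some (j, decide (0 ≤ θ (b.coord k)))}
      = ({θ | 0 ≤ θ (b.coord k)} ∩ {_θ | C k ≠ some (j, true)}) ∪
        ({θ | 0 ≤ θ (b.coord k)}ᶜ ∩ {_θ | C k ≠ some (j, false)}) := by
    ext θ
    by_cases h : 0 ≤ θ (b.coord k) <;> simp [h]
  rw [h2]
  exact (h1.inter (MeasurableSet.const _)).union (h1.compl.inter (MeasurableSet.const _))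

/-- The left side is ξ^(19/20), at most u^(19/20) = u · u^(-1/20). It shows that K = (m/δ)^(1/20) is
too small to offset δ/m. -/
theorem exp_div_mul_le {ξ u c : ℝ} (hξ : 0 < ξ) (hξu : ξ ≤ u) (hc : 0 < c) (hu : u⁻¹ ≤ c ^ 20) :
    Real.exp (Real.log ξ⁻¹ / 20) * ξ ≤ u * c := by
  have hu0 : 0 < u := hξ.trans_le hξu
  have h1 : Real.log ξ ≤ Real.log u := Real.log_le_log hξ hξu
  have h2 : Real.log u⁻¹ ≤ 20 * Real.log c := by
    have := Real.log_le_log (inv_pos.2 hu0) hu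
    rwa [Real.log_pow, Nat.cast_ofNat] at this
  rw [Real.log_inv] at h2 ⊢
  calc Real.exp (-Real.log ξ / 20) * ξ = Real.exp (-Real.log ξ / 20 + Real.log ξ) := by
        rw [Real.exp_add, Real.exp_log hξ]
    _ ≤ Real.exp (Real.log u + Real.log c) := Real.exp_le_exp.2 (by linarith)
    _ = u * c := by rw [Real.exp_add, Real.exp_log hu0, Real.exp_log hc]

open Classical in
/-- The lower bound of order `n * log (m / δ) / ε ^ 2`. -/
theorem Blocks.exists_expectedSamples_ge (b : Blocks d m L n) (hm : 0 < m) (hL : 0 < L)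
    (hn : n ≤ 2 * (m * L)) {ε δ : ℝ} (hε : 0 < ε) (hδ : 0 < δ) (hδ1 : δ < 1 / 8)
    (ha : 0 ≤ 3 * ε) (ha1 : 3 * ε ≤ 3 / 8) (hcase : m = 1 ∨ δ / m ≤ 1 / 10000)
    (A : Algorithm n (Fin d → ℝ) (Option (Fin d × Bool)))
    (hA : ∀ C, A.Solves (cubeModel d) (b.prob ha ha1 C) ε δ) :
    ∃ C, ENNReal.ofReal (n * Real.log (m / δ) / (261792000 * ε ^ 2)) ≤
      A.expectedSamples (b.prob ha ha1 C) := by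
  by_contra! hlt
  have hm' : (1 : ℝ) ≤ m := by exact_mod_cast hm
  have hL' : (0 : ℝ) < L := by positivity
  have hn0 : 0 < n := Fin.pos (b.arm ⟨0, hm⟩ ⟨0, hL⟩)
  have hn' : (n : ℝ) ≤ 2 * (m * L) := by exact_mod_cast hn
  set l : ℝ := Real.log (m / δ) with hl
  have hl0 : 0 < l := Real.log_pos (by rw [lt_div_iff₀ hδ]; linarith)
  -- At a = 3ε the second moment per sample is 1 + 216ε², and 4320 = 20 · 216, so B samples give at
  -- most (m/δ)^(1/20).
  set B : ℝ := l / (4320 * ε ^ 2) with hB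
  have hBpos : 0 < B := by positivity
  obtain ⟨q, halt, out, hdet⟩ := A.exists_deterministic (fun C => b.prob ha ha1 C)
    (fun C => ∏ k, blockPrior L (C k)) (fun C => Finset.prod_pos fun k _ => blockPrior_pos hL _)
    (by
      rw [← Fintype.prod_sum fun (_ : Fin m) (c : Option (Fin L × Bool)) => blockPrior L c]
      exact Finset.prod_eq_one fun _ _ => sum_blockPrior hL)
    b.good b.measurableSet_good hδ (by linarith)
    (B := n * l / (261792000 * ε ^ 2)) (by positivity)
    (fun C => (hA C).trans (measure_mono fun ω ⟨t, ht, hopt⟩ =>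
      ⟨t, ht, fun k j => b.ne_of_isEpsOptimal ha ha1 hε C hopt k j⟩)) fun C => (hlt C).le
  obtain ⟨T, h1, h2, h3⟩ := hdet (1 / 200) (by norm_num)
  have hmass : ∀ C, masses (b.prob ha ha1 C) = b.mass (3 * ε) C := by
    intro C
    funext i z
    exact finiteProb_real _ _ _ z
  simp only [hmass] at h1 h2 h3
  have hS : 3 * (101 * (n * l / (261792000 * ε ^ 2))) / (B * (m * L)) ≤ 1 / 100 := by
    rw [div_le_iff₀ (by positivity), hB]
    have : 3 * (101 * (n * l / (261792000 * ε ^ 2))) = n * (l / (864000 * ε ^ 2)) := by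
      field_simp; norm_num
    rw [this]
    have h5 : 1 / 100 * (l / (4320 * ε ^ 2) * (m * L)) = 2 * (m * L) * (l / (864000 * ε ^ 2)) := by
      field_simp; norm_num
    rw [h5]
    gcongr
  have hK : (1 + 24 * (3 * ε) ^ 2) ^ B ≤ Real.exp (Real.log (δ / m)⁻¹ / 20) := by
    rw [inv_div, ← hl]
    calc _ ≤ (Real.exp (216 * ε ^ 2)) ^ B := by
          apply Real.rpow_le_rpow (by positivity) _ hBpos.le
          linarith [Real.add_one_le_exp (216 * ε ^ 2)]
      _ = Real.exp (l / 20) := by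
          rw [← Real.exp_mul]
          congr 1
          rw [hB]; field_simp; norm_num
  have hξ : 0 < δ / m := by positivity
  rcases hcase with rfl | hcase
  · have := b.sq_le_of_mostly_correct hm hL ha ha1 halt T out (x := 98 / 100) hBpos h1 h2 h3
      (Or.inl ⟨rfl, rfl, rfl⟩) (by norm_num) (by linarith)
    have h4 := exp_div_mul_le hξ (u := 1 / 8) (c := 12 / 10) (by simpa using hδ1.le)
      (by norm_num) (by norm_num)
    have h5 := (mul_le_mul_of_nonneg_right hK hξ.le).trans h4
    simp only [Nat.cast_one, div_one] at h5
    nlinarith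
  · have := b.sq_le_of_mostly_correct hm hL ha ha1 halt T out (x := 2 / 10) hBpos h1 h2 h3
      (Or.inr ⟨rfl, rfl⟩) (by norm_num) (by linarith)
    have h4 := exp_div_mul_le hξ hcase (c := 2) (by norm_num) (by norm_num)
    have h5 := (mul_le_mul_of_nonneg_right hK hξ.le).trans h4
    have h6 : 2 * (101 / 100 * δ) / (m : ℝ) = 202 / 100 * (δ / m) := by ring
    rw [h6] at this
    nlinarith

/-- The choice of the number of blocks. -/
theorem exists_card_blocks {N : ℕ} (hN : 0 < N) {δ y : ℝ} (hδ : 0 < δ) (hδ1 : δ < 1 / 8)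
    (hy : 0 < y) (hyN : y ≤ N) : ∃ m : ℕ, 0 < m ∧ m ≤ N ∧ (m = 1 ∨ δ / m ≤ 1 / 10000) ∧
      Real.log (y / δ) ≤ 5 * Real.log (m / δ) := by
  have hN' : (0 : ℝ) < N := by positivity
  have h1 : Real.log (y / δ) ≤ Real.log (N / δ) :=
    Real.log_le_log (by positivity) (by gcongr)
  -- If δ/N is not small, then N/δ < 10⁴ < 8⁵ while 1/δ > 8, so one block loses only a factor 5 in
  -- the logarithm.
  by_cases hc : δ / N ≤ 1 / 10000
  · refine ⟨N, hN, le_rfl, Or.inr hc, ?_⟩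
    have : 0 ≤ Real.log (N / δ) := by
      apply Real.log_nonneg
      rw [le_div_iff₀ hδ]
      have : (1 : ℝ) ≤ N := by exact_mod_cast hN
      linarith
    linarith
  · refine ⟨1, one_pos, hN, Or.inl rfl, ?_⟩
    rw [not_le, lt_div_iff₀ hN'] at hc
    have h2 : Real.log (N / δ) ≤ Real.log ((8 : ℝ) ^ 5) := by
      apply Real.log_le_log (by positivity)
      rw [div_le_iff₀ hδ]
      norm_num
      linarith
    have h3 : Real.log 8 ≤ Real.log ((1 : ℕ) / δ) := by
      apply Real.log_le_log (by norm_num)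
      rw [le_div_iff₀ hδ]
      push_cast
      linarith
    rw [Real.log_pow] at h2
    push_cast at h2 h3 ⊢
    linarith

end Groups

end GroupDRO

end

/-! ### The lower bound -/

theorem mainTheorem10 :
    ∃ c : ℝ, 0 < c ∧
      ∀ (n : ℕ) (D ε δ : ℝ), 1 ≤ n → 1 / 8 ≤ D →
        ε ∈ Set.Ioo (0 : ℝ) (1 / 8) → δ ∈ Set.Ioo (0 : ℝ) (1 / 8) →
        ∃ (E : Type) (_ : NormedAddCommGroup E) (_ : NormedSpace ℝ E)
          (_ : FiniteDimensional ℝ E) (_ : MeasurableSpace E) (_ : BorelSpace E)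
          (Z : Type) (_ : MeasurableSpace Z) (M : GroupDRO.Model E Z)
          (ω : E → ℝ) (ω' : E → StrongDual ℝ E)
          (𝒱 : Set (Fin n → MeasureTheory.ProbabilityMeasure Z)),
          M.IsOneSmooth ∧
          Metric.diam M.Θ = 1 ∧
          GroupDRO.IsDistanceGenerating M.Θ ω ω' ∧
          GroupDRO.IsBregmanRadius M.Θ ω ω' D ∧
          𝒱.Finite ∧
          ∀ A : GroupDRO.Algorithm n E Z, (∀ P ∈ 𝒱, A.Solves M P ε δ) →
            ∃ P ∈ 𝒱,
              ENNReal.ofReal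
                  (c * ((D + (n : ℝ) * Real.log (min (n : ℝ) D / δ)) / ε ^ 2)) ≤
                A.expectedSamples P := by
  refine ⟨1 / 10 ^ 11, by positivity, ?_⟩
  intro n D ε δ hn hD ⟨hε, hε1⟩ ⟨hδ, hδ1⟩
  obtain ⟨d, hd, hdD, hDd⟩ : ∃ d : ℕ, 0 < d ∧ (d : ℝ) ≤ 8 * D ∧ 8 * D < d + 1 :=
    ⟨⌊8 * D⌋₊, Nat.floor_pos.2 (by linarith), Nat.floor_le (by linarith), Nat.lt_floor_add_one _⟩
  have hd1 : (1 : ℝ) ≤ d := by exact_mod_cast hd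
  have hn1 : (1 : ℝ) ≤ n := by exact_mod_cast hn
  have hmin : 0 < min (n : ℝ) D := lt_min (by linarith) (by linarith)
  have hsq : 0 < ε ^ 2 := by positivity
  suffices h : ∃ 𝒱 : Set (Fin n → MeasureTheory.ProbabilityMeasure (Option (Fin d × Bool))),
      𝒱.Finite ∧ ∀ A : GroupDRO.Algorithm n (Fin d → ℝ) (Option (Fin d × Bool)),
        (∀ P ∈ 𝒱, A.Solves (GroupDRO.cubeModel d) P ε δ) →
        ∃ P ∈ 𝒱, ENNReal.ofReal
          (1 / 10 ^ 11 * ((D + (n : ℝ) * Real.log (min (n : ℝ) D / δ)) / ε ^ 2)) ≤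
            A.expectedSamples P by
    obtain ⟨𝒱, hfin, h𝒱⟩ := h
    -- Rounding 8D down to `d` leaves this multiple at least 1, as strong convexity requires, and
    -- makes the radius exactly D.
    have hc : 1 ≤ 8 * D / d := by rwa [one_le_div (by linarith)]
    have hrad := GroupDRO.isBregmanRadius_quadratic (d := d) (c := 8 * D / d) (by linarith)
    have e : 8 * D / d * d / 8 = D := by field_simp
    rw [e] at hrad
    exact ⟨Fin d → ℝ, inferInstance, inferInstance, inferInstance, inferInstance, inferInstance,
      Option (Fin d × Bool), inferInstance, GroupDRO.cubeModel d,
      GroupDRO.quadratic d (8 * D / d), GroupDRO.quadraticDeriv d (8 * D / d), 𝒱,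
      GroupDRO.cubeModel_isOneSmooth d, GroupDRO.diam_cube hd,
      GroupDRO.isDistanceGenerating_quadratic hc, hrad, hfin, h𝒱⟩
  -- The family may depend on all parameters, so only the larger term has to be matched.
  rcases le_total ((n : ℝ) * Real.log (min (n : ℝ) D / δ)) D with hle | hle
  · have hb : |7 * ε| ≤ 1 := by rw [abs_of_pos (by positivity)]; linarith
    refine ⟨Set.range fun (v : Fin d → Bool) (_ : Fin n) => GroupDRO.biasedProb hd hb v,
      Set.finite_range _, fun A hA => ?_⟩
    obtain ⟨v, hv⟩ := GroupDRO.exists_expectedSamples_ge_dimension hd hn hε hε1 hδ hδ1 hb A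
      fun v => hA _ ⟨v, rfl⟩
    refine ⟨_, ⟨v, rfl⟩, le_trans (ENNReal.ofReal_le_ofReal ?_) hv⟩
    have h1 : (d : ℝ) / (101 * (4 * 10 ^ 8 * ε ^ 2)) = d / (101 * (4 * 10 ^ 8)) / ε ^ 2 := by
      field_simp
    rw [h1, ← mul_div_assoc]
    gcongr
    norm_num
    linarith
  · obtain ⟨m, hm, hmN, hcase, hlog⟩ := GroupDRO.exists_card_blocks (N := min n d)
      (lt_min hn hd) hδ hδ1 hmin (by
        push_cast
        exact min_le_min le_rfl (by linarith))
    have hmn : m ≤ n := hmN.trans (min_le_left _ _)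
    have hL : 0 < n / m := Nat.div_pos hmn hm
    have ha : 0 ≤ 3 * ε := by positivity
    have ha1 : 3 * ε ≤ 3 / 8 := by linarith
    let b := GroupDRO.Blocks.ofLe hm (hmN.trans (min_le_right _ _)) (Nat.mul_div_le n m)
    -- Rounding `n / m` down leaves fewer than `m` oracles unlisted, at most half of them because `m
    -- ≤ n`.
    have hn2 : n ≤ 2 * (m * (n / m)) := by
      have h1 := Nat.div_add_mod n m
      have h2 := Nat.mod_lt n hm
      have h3 : m * 1 ≤ m * (n / m) := Nat.mul_le_mul_left m hL
      omega
    refine ⟨Set.range fun C => b.prob ha ha1 C, Set.finite_range _, fun A hA => ?_⟩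
    obtain ⟨C, hC⟩ := b.exists_expectedSamples_ge hm hL hn2 hε hδ hδ1 ha ha1 hcase A
      fun C => hA _ ⟨C, rfl⟩
    refine ⟨_, ⟨C, rfl⟩, le_trans (ENNReal.ofReal_le_ofReal ?_) hC⟩
    have h1 : (n : ℝ) * Real.log (m / δ) / (261792000 * ε ^ 2)
        = n * Real.log (m / δ) / 261792000 / ε ^ 2 := by field_simp
    rw [h1, ← mul_div_assoc]
    have h2 : (n : ℝ) * Real.log (min (n : ℝ) D / δ) ≤ n * (5 * Real.log (m / δ)) := by gcongr
    gcongr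
    norm_num
    linarith
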